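/- Let $\Bbbk$ be an algebraically closed field, let $n,\omega\ge 1$ be integers, and let $\Delta_n$ be the equioriented cycle: the quiver with vertex set $\mathbb{Z}_n=\mathbb{Z}/n\mathbb{Z}$ and exactly one arrow $i\to i+1$ for each $i\in\mathbb{Z}_n$. Let $\mathrm{I}_{\omega n}$ be the two-sided ideal of the path algebra $\Bbbk\Delta_n$ generated by all paths of length $\omega n$, and for $i,j\in\mathbb{Z}_n$ let $P_i^\omega$ and $I_j^\omega$ be the projective representation at $i$ and the injective representation at $j$ of the bound quiver $(\Delta_n,\mathrm{I}_{\omega n})$. (Over a vertex $l$, the space of $P_i^\omega$ has as basis the nonzero residue classes of paths from $i$ to $l$, with arrows acting by concatenation; the space of $I_j^\omega$ has as basis the nonzero residue classes of paths from $l$ to $j$, where an arrow $\alpha$ sends the class of $\alpha p$ to the class of $p$, and the classes of paths not starting with $\alpha$ to $0$.) Let $x_i,y_i\in\mathbb{Z}_{\ge 0}$ for $i\in\mathbb{Z}_n$, and put $$X_\omega:=\bigoplus_{i\in\mathbb{Z}_n}P_i^\omega\otimes\Bbbk^{x_i},\qquad Y_\omega:=\bigoplus_{j\in\mathbb{Z}_n}I_j^\omega\otimes\Bbbk^{y_j},\qquad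 \mathbf{e}_\omega:=\mathbf{dim}\,X_\omega,$$ $$k:=\sum_{i\in\mathbb{Z}_n}x_i,\qquad m:=\sum_{i\in\mathbb{Z}_n}(x_i+y_i).$$ Let $\mathrm{Gr}^{\Delta_n}_{\mathbf{e}_\omega}(X_\omega\oplus Y_\omega)$ be the quiver Grassmannian, i.e. the set of all subrepresentations of $X_\omega\oplus Y_\omega$ with dimension vector $\mathbf{e}_\omega$, with the Zariski topology as a closed subvariety of the product over the vertices of the Grassmannians of subspaces. Then its (Krull) dimension is $$\dim \mathrm{Gr}^{\Delta_n}_{\mathbf{e}_\omega}(X_\omega\oplus Y_\omega)=\omega k(m-k).$$ -/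

import Mathlib

/-! ### Representations of quivers -/

/-- A representation of a quiver `Q` over `k`: a vector space `V i` at every vertex `i` and a
linear map along every arrow. -/
structure QuiverRep.{w, u, v, q} (k : Type u) [Field k] (Q : Type q) [Quiver.{v} Q] where
  /-- the vector spaces at the vertices -/
  V : Q → Type w
  [addCommGroup : ∀ i, AddCommGroup (V i)]
  [module : ∀ i, Module k (V i)]
  /-- the linear maps along the arrows -/
  map : ∀ {i j : Q}, (i ⟶ j) → (V i →ₗ[k] V j)

attribute [instance] QuiverRep.addCommGroup QuiverRep.module

namespace QuiverRep

universe w u v q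

variable {k : Type u} [Field k] {Q : Type q} [Quiver.{v} Q]

/-- The dimension vector (of a representation by finite-dimensional spaces). -/
noncomputable def dimVec (R : QuiverRep.{w} k Q) (i : Q) : ℕ :=
  Module.finrank k (R.V i)

/-- The direct sum of two representations. -/
def prod (R S : QuiverRep.{w} k Q) : QuiverRep.{w} k Q where
  V i := R.V i × S.V i
  map α := (R.map α).prodMap (S.map α)

/-- The direct sum of a finite family of representations. -/
def pi {ι : Type} [Finite ι] (R : ι → QuiverRep.{w} k Q) : QuiverRep.{w} k Q where
  V i := ∀ s, (R s).V i
  map α := LinearMap.pi fun s => (R s).map α ∘ₗ LinearMap.proj s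

/-- The direct sum `⨁ i, R i ⊗ k ^ (x i)`, that is, the direct sum of `x i` copies of `R i`,
over all `i` in a finite index type. -/
def sumCopies {ι : Type} [Finite ι] (R : ι → QuiverRep.{w} k Q) (x : ι → ℕ) :
    QuiverRep.{w} k Q :=
  pi fun s : Σ i, Fin (x i) => R s.1

/-- A tuple of subspaces is a subrepresentation if it is compatible with all the maps. -/
def IsSubrep (R : QuiverRep.{w} k Q) (U : ∀ i, Submodule k (R.V i)) : Prop :=
  ∀ ⦃i j : Q⦄ (α : i ⟶ j), (U i).map (R.map α) ≤ U j

end QuiverRep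

/-! ### The Zariski topology on a product of Grassmannians -/

section Zariski

universe w u q

/-- The closed points version of the Zariski topology on a finite-dimensional vector space `W`:
the closed sets are the common zero sets of families of polynomials in linear coordinates. -/
@[reducible]
def zariskiTopology (k : Type u) [Field k] (W : Type w) [AddCommGroup W] [Module k W] :
    TopologicalSpace W :=
  TopologicalSpace.ofClosed
    {Z | ∃ S : Set (MvPolynomial (Module.Dual k W) k),
      Z = {w | ∀ p ∈ S, MvPolynomial.eval (fun φ : Module.Dual k W => φ w) p = 0}}
    ⟨{1}, by ext w; simp⟩
    (by
      intro A hA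
      refine ⟨{p | ∃ Z ∈ A, ∀ w ∈ Z,
        MvPolynomial.eval (fun φ : Module.Dual k W => φ w) p = 0}, ?_⟩
      ext w
      constructor
      · rintro hw p ⟨Z, hZ, hp⟩
        exact hp w (hw Z hZ)
      · intro hw Z hZ
        obtain ⟨S, rfl⟩ := hA hZ
        exact fun p hp => hw p ⟨_, hZ, fun w' hw' => hw' p hp⟩)
    (by
      rintro _ ⟨S, rfl⟩ _ ⟨T, rfl⟩
      refine ⟨{r | ∃ p ∈ S, ∃ q ∈ T, r = p * q}, ?_⟩
      ext w
      constructor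
      · rintro (hw | hw) _ ⟨p, hp, q, hq, rfl⟩
        · simp [hw p hp]
        · simp [hw q hq]
      · intro hw
        by_contra hcon
        simp only [Set.mem_union, Set.mem_ofPred_eq, not_or, not_forall] at hcon
        obtain ⟨⟨p, hp, hp'⟩, q, hq, hq'⟩ := hcon
        have h := hw _ ⟨p, hp, q, hq, rfl⟩
        rw [map_mul] at h
        exact (mul_ne_zero hp' hq') h)

variable (k : Type u) [Field k] {I : Type q} (V : I → Type w) [∀ i, AddCommGroup (V i)]
  [∀ i, Module k (V i)] (e : I → ℕ)

/-- The product over `i` of the Grassmannians of `e i`-dimensional subspaces of `V i`. -/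
def MultiGrassmannian : Type (max q w) :=
  {U : ∀ i, Submodule k (V i) //
    ∀ i, FiniteDimensional k (U i) ∧ Module.finrank k (U i) = e i}

/-- Frames: tuples of linearly independent families of `e i` vectors of `V i`. They form an open
subset of the vector space `∏ i, (V i) ^ (e i)`. -/
def MultiFrame : Type (max q w) :=
  {F : ∀ i, Fin (e i) → V i // ∀ i, LinearIndependent k (F i)}

/-- Frames carry the subspace topology of the Zariski topology. -/
instance MultiFrame.topologicalSpace : TopologicalSpace (MultiFrame k V e) :=
  TopologicalSpace.induced Subtype.val (zariskiTopology k (∀ i, Fin (e i) → V i))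

variable {k V e} in
/-- The tuple of subspaces spanned by a frame. -/
def MultiFrame.span (F : MultiFrame k V e) : MultiGrassmannian k V e :=
  ⟨fun i => Submodule.span k (Set.range (F.1 i)), fun i =>
    ⟨FiniteDimensional.span_of_finite k (Set.finite_range _), by
      rw [finrank_span_eq_card (F.2 i), Fintype.card_fin]⟩⟩

/-- The Zariski topology of the product of Grassmannians, as the quotient of the variety of frames
by the base change group `∏ i, GL (e i)`: a set is closed if and only if
the set of frames that span a point of it is closed. -/
instance MultiGrassmannian.topologicalSpace : TopologicalSpace (MultiGrassmannian k V e) :=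
  TopologicalSpace.coinduced MultiFrame.span (MultiFrame.topologicalSpace k V e)

end Zariski

/-! ### Quiver Grassmannians -/

/-- The quiver Grassmannian of all subrepresentations of `R` of dimension vector `e`. -/
def QuiverRep.Grassmannian.{w, u, v, q} {k : Type u} [Field k] {Q : Type q} [Quiver.{v} Q]
    (R : QuiverRep.{w} k Q) (e : Q → ℕ) : Type (max q w) :=
  {U : MultiGrassmannian k R.V e // R.IsSubrep U.1}

/-- The quiver Grassmannian has the Zariski topology as a subvariety of the product of the
Grassmannians at the vertices. -/
instance QuiverRep.Grassmannian.topologicalSpace.{w, u, v, q} {k : Type u} [Field k] {Q : Type q}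
    [Quiver.{v} Q] (R : QuiverRep.{w} k Q) (e : Q → ℕ) : TopologicalSpace (R.Grassmannian e) :=
  TopologicalSpace.induced Subtype.val (MultiGrassmannian.topologicalSpace k R.V e)

/-! ### Bound quivers with all paths of length `N` as relations -/

namespace BoundQuiver

open Quiver

universe u v q

variable (k : Type u) [Field k] {Q : Type q} [Quiver.{v} Q] (N : ℕ)

/-- The part `I_N(i, j)` spanned by paths from `i` to `j` of the two-sided ideal `I_N` of the path
algebra that is generated by all paths of length `N`. Here `Path i j →₀ k` is the part of the path
algebra with the paths from `i` to `j` as basis. -/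
noncomputable def ideal (i j : Q) : Submodule k (Path i j →₀ k) :=
  Submodule.span k {f | ∃ (a b : Q) (p : Path i a) (r : Path a b) (s : Path b j),
    r.length = N ∧ f = Finsupp.single ((p.comp r).comp s) 1}

/-- The part from `i` to `j` of the bound path algebra: the quotient of the path algebra
by `I_N`. -/
abbrev PathSpace (i j : Q) : Type (max u v q) :=
  (Path i j →₀ k) ⧸ ideal k N i j

/-- Composition with an arrow at the end of paths. -/
noncomputable def PathSpace.append (i : Q) {j j' : Q} (α : j ⟶ j') :
    PathSpace k N i j →ₗ[k] PathSpace k N i j' :=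
  Submodule.mapQ _ _ (Finsupp.lmapDomain k k fun p : Path i j => p.cons α) <| by
    rw [ideal, Submodule.span_le]
    rintro _ ⟨a, b, p, r, s, hr, rfl⟩
    refine Submodule.subset_span ⟨a, b, p, r, s.cons α, hr, ?_⟩
    simp [Finsupp.mapDomain_single]

/-- Composition with an arrow at the start of paths. -/
noncomputable def PathSpace.prepend {i i' : Q} (α : i ⟶ i') (j : Q) :
    PathSpace k N i' j →ₗ[k] PathSpace k N i j :=
  Submodule.mapQ _ _ (Finsupp.lmapDomain k k fun p : Path i' j => α.toPath.comp p) <| by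
    rw [ideal, Submodule.span_le]
    rintro _ ⟨a, b, p, r, s, hr, rfl⟩
    refine Submodule.subset_span ⟨a, b, α.toPath.comp p, r, s, hr, ?_⟩
    simp [Finsupp.mapDomain_single, Path.comp_assoc]

/-- The projective representation `P_i` of the bound quiver: over the vertex `j` it has the space
generated by the classes of paths from `i` to `j`, and the arrows act by concatenation. -/
noncomputable def projective (i : Q) : QuiverRep.{max u v q} k Q where
  V j := PathSpace k N i j
  map α := PathSpace.append k N i α

/-- The injective representation `I_j` of the bound quiver: over the vertex `i` it has the dual of
the space generated by the classes of paths from `i` to `j`, and an arrow `α` acts by the transpose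
of the concatenation with `α`. (On the basis dual to the paths that are nonzero modulo `I_N`,
the arrow `α` sends a path `α p` to `p` and all other paths to zero.) -/
noncomputable def injective (j : Q) : QuiverRep.{max u v q} k Q where
  V i := Module.Dual k (PathSpace k N i j)
  map α := (PathSpace.prepend k N α j).dualMap

end BoundQuiver

/-! ### The equioriented cycle -/

/-- The vertices of the equioriented cycle on `n` vertices. -/
def CyclicQuiver (n : ℕ) : Type := ZMod n

/-- There is exactly one arrow `i ⟶ i + 1` for every vertex `i`, and there are no other arrows. -/
instance CyclicQuiver.quiver (n : ℕ) : Quiver.{0} (CyclicQuiver n) where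
  Hom (i j : ZMod n) := PLift (i + 1 = j)

instance CyclicQuiver.fintype (n : ℕ) [NeZero n] : Fintype (CyclicQuiver n) :=
  inferInstanceAs (Fintype (ZMod n))

/-! Put `N = ω n`. Each `P_i` and each `I_j` is a string of length `N`: a uniserial representation
whose arrows shift a basis. So `M = X ⊕ Y` consists of `m` such strings, of which `k` form `X`, and
`X` has constant dimension vector `K = ω k`.

Lower bound: graphs of homomorphisms `X → Y` are points of the Grassmannian. Strings of length `N`
are free on their first vector, so `dim Hom(X, Y) = ω k (m - k)`. Coordinate subspaces of this
affine space give a chain of irreducible closed sets of that length (`le_topologicalKrullDim_prod`).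

Upper bound: a subrepresentation `U` is a sum of strings (arcs on the cycle), so only finitely many
isomorphism types occur. The stratum of one type is parametrized by embeddings `U → M` modulo `Aut
U`. Its expected dimension is at most `dim Hom(U, M) - dim End U`, where `dim Hom(U, M) = m K`
because `M` is injective among the representations killed by paths of length `N`. It remains to see
`dim End U ≥ ω k²`, which is `sum_arcCount_ge`: the numbers `dim Hom(string, U)` are subadditive
under concatenation of strings, and a shortest-path potential on the cycle turns this into the
bound.

Dimensions of strata are replaced by counts of algebraically independent functions on frames. A
chain of length `L` in the Grassmannian gives `L + ∑ e_i²` functions that are algebraically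
independent on all frames (`exists_algIndep_of_chain`). If `L` is too large, they satisfy a nonzero
relation on each stratum (`exists_relation_of_arcs`), and the product of these finitely many
relations is a contradiction. -/

/-! ### Arcs on a cycle -/

section Arcs

variable {n : ℕ} {Γ : Type*} (q : Γ → ZMod n) (len : Γ → ℕ)

/-- The points of a family of arcs, where the arc `g` has `len g` points. -/
abbrev ArcPoint : Type _ := Σ g : Γ, Fin (len g)

/-- The vertex of the cycle below a point of an arc, where the arc `g` starts at `q g`. -/
def arcVertex (x : ArcPoint len) : ZMod n := q x.1 + (x.2 : ℕ)

/-- The number of points of an arc from a given point on. -/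
def arcHeight {len : Γ → ℕ} (x : ArcPoint len) : ℕ := len x.1 - x.2

variable [Fintype Γ]

/-- The number of points over a vertex of height at most `l`. -/
def arcCount (i : ZMod n) (l : ℕ) : ℕ :=
  (Finset.univ.filter fun x : ArcPoint len => arcVertex q len x = i ∧ arcHeight x ≤ l).card

/-- The number of points over a vertex of height in `(s, t]`. -/
def arcSlice (i : ZMod n) (s t : ℕ) : ℕ :=
  (Finset.univ.filter fun x : ArcPoint len =>
    arcVertex q len x = i ∧ s < arcHeight x ∧ arcHeight x ≤ t).card

variable {q len}

theorem arcCount_add_arcSlice (i : ZMod n) {s t : ℕ} (h : s ≤ t) :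
    arcCount q len i s + arcSlice q len i s t = arcCount q len i t := by
  classical
  rw [arcCount, arcSlice, arcCount, ← Finset.card_union_of_disjoint]
  · congr 1
    ext x
    simp only [Finset.mem_union, Finset.mem_filter, Finset.mem_univ, true_and]
    grind
  · rw [Finset.disjoint_filter]
    grind

/-- Moving a point `a` steps along its arc is injective and lowers its height by `a`; height above
`a` guarantees that it stays on the arc. -/
theorem arcSlice_add_le (i : ZMod n) (s t a : ℕ) :
    arcSlice q len i (s + a) (t + a) ≤ arcSlice q len (i + a) s t := by
  have key : ∀ x : ArcPoint len, s + a < arcHeight x → (x.2 : ℕ) + a < len x.1 := by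
    intro x hx
    unfold arcHeight at hx
    omega
  -- The `else` value is a dummy: by `key` it is never taken on the points being counted.
  refine Finset.card_le_card_of_injOn
    (fun x => if h : (x.2 : ℕ) + a < len x.1 then ⟨x.1, ⟨x.2 + a, h⟩⟩ else x) ?_ ?_
  · intro x hx
    simp only [Finset.coe_filter, Finset.mem_univ, true_and, Set.mem_ofPred_eq] at hx ⊢
    have h1 := key x hx.2.1
    rw [dif_pos h1]
    obtain ⟨hv, h2, h3⟩ := hx
    unfold arcVertex at *
    unfold arcHeight at *
    refine ⟨?_, ?_, ?_⟩
    · rw [← hv]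
      push_cast
      ring
    · simp only
      omega
    · simp only
      omega
  · intro x hx y hy hxy
    simp only [Finset.coe_filter, Finset.mem_univ, true_and, Set.mem_ofPred_eq] at hx hy
    have h1 := key x hx.2.1
    have h2 := key y hy.2.1
    simp only [dif_pos h1, dif_pos h2] at hxy
    obtain ⟨g, x⟩ := x
    obtain ⟨g', y⟩ := y
    obtain ⟨rfl, h⟩ := Sigma.mk.inj_iff.1 hxy
    have h' := congrArg Fin.val (eq_of_heq h)
    simp only [Nat.add_right_cancel_iff] at h'
    rw [Fin.ext h']

theorem arcSlice_zero_le (i : ZMod n) (t : ℕ) : arcSlice q len i 0 t ≤ arcCount q len i t :=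
  Finset.card_le_card fun x => by
    simp only [Finset.mem_filter, Finset.mem_univ, true_and]
    tauto

/-- For the sum `U` of the strings, with shift `A`, `arcCount i l` is the dimension of the kernel of
`A ^ l` on `U_i`, that is, of the homomorphisms to `U` from a string of length `l` starting at `i`.
The inequality is the usual one for the kernel of a composite `A ^ l ∘ A ^ a`. -/
theorem arcCount_add_le (i : ZMod n) (a l : ℕ) :
    arcCount q len i (a + l) ≤ arcCount q len i a + arcCount q len (i + a) l := by
  have h1 := arcCount_add_arcSlice (q := q) (len := len) i (Nat.le_add_right a l)
  have h2 := arcSlice_add_le (q := q) (len := len) i 0 l a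
  have h3 := arcSlice_zero_le (q := q) (len := len) (i + a) l
  rw [zero_add, add_comm l a] at h2
  omega

/-- The version for concatenations longer than `N`. A further `N - a` steps lead from `i + a` back
to `i`, and carry the points with height in `(l, N]` injectively to points with height in `(a + l -
N, a]`. -/
theorem arcCount_add_le_of_dvd {N : ℕ} (hN : (N : ZMod n) = 0) (i : ZMod n) {a l : ℕ}
    (ha : a ≤ N) (hl : l ≤ N) (h : N ≤ a + l) :
    arcCount q len (i + a) N + arcCount q len i (a + l - N) ≤
      arcCount q len i a + arcCount q len (i + a) l := by
  have h1 := arcCount_add_arcSlice (q := q) (len := len) (i + a) hl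
  have h2 := arcCount_add_arcSlice (q := q) (len := len) i (show a + l - N ≤ a by omega)
  have h3 := arcSlice_add_le (q := q) (len := len) (i + a) (a + l - N) a (N - a)
  have h4 : i + (a : ZMod n) + ((N - a : ℕ) : ZMod n) = i := by
    rw [Nat.cast_sub ha, hN]
    ring
  rw [h4, show a + l - N + (N - a) = l by omega, show a + (N - a) = N by omega] at h3
  omega

theorem arcCount_zero (i : ZMod n) : arcCount q len i 0 = 0 := by
  rw [arcCount, Finset.card_eq_zero, Finset.filter_eq_empty_iff]
  rintro ⟨g, r⟩ -
  have := r.2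
  simp only [arcHeight]
  omega

theorem arcCount_eq_card {N : ℕ} (hlen : ∀ g, len g ≤ N) (i : ZMod n) :
    arcCount q len i N =
      (Finset.univ.filter fun x : ArcPoint len => arcVertex q len x = i).card := by
  rw [arcCount]
  congr 1
  ext x
  have := hlen x.1
  simp only [Finset.mem_filter, Finset.mem_univ, true_and, and_iff_left_iff_imp]
  unfold arcHeight
  omega

/-- If all vertices have `K` points over them, the multiset of the start vertices of the arcs
agrees with the one of their end vertices. -/
theorem sum_arc_end_sub_start [NeZero n] {K : ℕ}
    (hK : ∀ i, (Finset.univ.filter fun x : ArcPoint len => arcVertex q len x = i).card = K)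
    (φ : ZMod n → ℤ) : ∑ g, (φ (q g + (len g : ℕ)) - φ (q g)) = 0 := by
  have h1 : ∀ ψ : ZMod n → ℤ, ∑ x : ArcPoint len, ψ (arcVertex q len x) = K * ∑ i, ψ i := by
    intro ψ
    rw [← Finset.sum_fiberwise Finset.univ (arcVertex q len), Finset.mul_sum]
    refine Finset.sum_congr rfl fun i _ => ?_
    rw [Finset.sum_congr rfl (g := fun _ => ψ i)
      (fun x hx => by rw [(Finset.mem_filter.1 hx).2]), Finset.sum_const, hK, nsmul_eq_mul]
  -- Telescoping along each arc gives a sum over all points, and since every vertex has `K` points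
  -- this is `K` times the sum of `φ (i + 1) - φ i` around the cycle.
  have h2 : ∀ g, φ (q g + (len g : ℕ)) - φ (q g) =
      ∑ r : Fin (len g), (φ (q g + ((r : ℕ) : ZMod n) + 1) - φ (q g + ((r : ℕ) : ZMod n))) := by
    intro g
    rw [Fin.sum_univ_eq_sum_range
      (fun r => φ (q g + (r : ZMod n) + 1) - φ (q g + (r : ZMod n)))]
    have := Finset.sum_range_sub (fun r : ℕ => φ (q g + (r : ZMod n))) (len g)
    simp only [Nat.cast_add, Nat.cast_one, Nat.cast_zero, add_zero, ← add_assoc] at this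
    exact this.symm
  rw [Finset.sum_congr rfl fun g _ => h2 g, ← Fintype.sum_sigma']
  change ∑ x : ArcPoint len, (φ (arcVertex q len x + 1) - φ (arcVertex q len x)) = 0
  rw [Finset.sum_sub_distrib, h1 fun i => φ (i + 1), h1 φ,
    Fintype.sum_equiv (Equiv.addRight (1 : ZMod n)) (fun i => φ (i + 1)) φ fun _ => rfl, sub_self]

theorem sum_len_eq [NeZero n] {K : ℕ}
    (hK : ∀ i, (Finset.univ.filter fun x : ArcPoint len => arcVertex q len x = i).card = K) :
    ∑ g, len g = n * K := by
  have h : Fintype.card (ArcPoint len) = n * K := by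
    rw [← Finset.card_univ, Finset.card_eq_sum_card_fiberwise
      (f := arcVertex q len) (t := Finset.univ) (fun _ _ => Finset.mem_univ _)]
    simp [hK, ZMod.card]
  rw [← h, Fintype.card_sigma]
  simp

/-- The lower bound for the dimension of the endomorphism ring of a nilpotent representation of
the cycle with constant dimension vector. -/
theorem sum_arcCount_ge [NeZero n] {K N : ℕ} (hN : (N : ZMod n) = 0) (hN0 : 0 < N)
    (hlen : ∀ g, len g ≤ N)
    (hK : ∀ i, (Finset.univ.filter fun x : ArcPoint len => arcVertex q len x = i).card = K) :
    n * K ^ 2 ≤ N * ∑ g, arcCount q len (q g) (len g) := by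
  -- Regard `G i l` as the cost of an edge from `i` to `i + l`. The claim says that the arcs have
  -- nonnegative total cost.
  set G : ZMod n → ℕ → ℤ := fun i l => N * arcCount q len i l - l * K with hG
  have hne : (Finset.range N).Nonempty := ⟨0, by simpa⟩
  -- A shortest-path potential: the cost of the cheapest edge into `i` of length below `N`.
  set φ : ZMod n → ℤ := fun i => (Finset.range N).inf' hne fun a => G (i - a) a with hφ
  have hKN : ∀ i, arcCount q len i N = K := fun i => by rw [arcCount_eq_card hlen, hK]
  have hφle : ∀ (i : ZMod n) (a : ℕ), a ≤ N → φ (i + a) ≤ G i a := by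
    intro i a ha
    have aux : ∀ b < N, φ (i + a) ≤ G (i + a - b) b := fun b hb =>
      Finset.inf'_le (fun b : ℕ => G (i + a - b) b) (Finset.mem_range.2 hb)
    -- Length `N` is outside the range of the minimum, but the constant dimension gives `G i N = 0`,
    -- the cost of the edge of length `0`.
    rcases ha.lt_or_eq with h | rfl
    · simpa using aux a h
    · have := aux 0 hN0
      simp only [hG, hKN, arcCount_zero] at this ⊢
      push_cast at this ⊢
      linarith
  have hsub : ∀ (i : ZMod n) (l : ℕ), l ≤ N → φ (i + l) - φ i ≤ G i l := by
    intro i l hl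
    obtain ⟨a, ha, hae⟩ := Finset.exists_mem_eq_inf' hne fun a : ℕ => G (i - a) a
    rw [Finset.mem_range] at ha
    change φ i = _ at hae
    rw [hae]
    have hi : i - (a : ZMod n) + a = i := by ring
    -- The cheapest edge into `i`, followed by the edge of length `l`, is dominated by one edge, of
    -- length `a + l` or, after removing a full `N`, of length `a + l - N`.
    by_cases hal : a + l ≤ N
    · have h1 := arcCount_add_le (q := q) (len := len) (i - a) a l
      have h2 := hφle (i - a) (a + l) hal
      rw [Nat.cast_add, ← add_assoc, hi] at h2
      rw [hi] at h1
      zify at h1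
      have h3 := mul_le_mul_of_nonneg_left h1 (Int.natCast_nonneg N)
      simp only [hG] at h2 ⊢
      push_cast at h2 ⊢
      linarith
    · have h1 := arcCount_add_le_of_dvd (q := q) (len := len) hN (i - a) ha.le hl (by omega)
      have h2 := hφle (i - a) (a + l - N) (by omega)
      rw [Nat.cast_sub (by omega), Nat.cast_add, hN, sub_zero, ← add_assoc, hi] at h2
      rw [hi, hKN] at h1
      zify at h1
      have h3 := mul_le_mul_of_nonneg_left h1 (Int.natCast_nonneg N)
      simp only [hG] at h2 ⊢
      rw [Nat.cast_sub (by omega)] at h2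
      push_cast at h2 ⊢
      linarith
  -- The potential differences cancel over all arcs, leaving `0 ≤ ∑ G`; the total length of the arcs
  -- is `n K`.
  have hsum := Finset.sum_le_sum fun g (_ : g ∈ Finset.univ) => hsub (q g) (len g) (hlen g)
  rw [sum_arc_end_sub_start hK] at hsum
  simp only [hG, Finset.sum_sub_distrib, ← Finset.mul_sum, ← Finset.sum_mul] at hsum
  have hl := sum_len_eq hK
  zify at hl ⊢
  rw [hl] at hsum
  linarith

end Arcs

/-! ### Polynomial functions -/

section IsPolyFun

variable {k : Type*} [Field k]

/-- Polynomial functions on `k ^ σ`. -/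
def IsPolyFun {σ : Type*} (f : (σ → k) → k) : Prop :=
  ∃ p : MvPolynomial σ k, ∀ x, f x = MvPolynomial.eval x p

namespace IsPolyFun

variable {σ τ ι : Type*} {f g : (σ → k) → k}

theorem const (c : k) : IsPolyFun fun _ : σ → k => c := ⟨MvPolynomial.C c, by simp⟩

theorem coord (s : σ) : IsPolyFun fun x : σ → k => x s := ⟨MvPolynomial.X s, by simp⟩

theorem add (hf : IsPolyFun f) (hg : IsPolyFun g) : IsPolyFun fun x => f x + g x := by
  obtain ⟨p, hp⟩ := hf
  obtain ⟨r, hr⟩ := hg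
  exact ⟨p + r, fun x => by simp [hp, hr]⟩

theorem mul (hf : IsPolyFun f) (hg : IsPolyFun g) : IsPolyFun fun x => f x * g x := by
  obtain ⟨p, hp⟩ := hf
  obtain ⟨r, hr⟩ := hg
  exact ⟨p * r, fun x => by simp [hp, hr]⟩

theorem sum {s : Finset ι} {F : ι → (σ → k) → k} (h : ∀ i ∈ s, IsPolyFun (F i)) :
    IsPolyFun fun x => ∑ i ∈ s, F i x := by
  choose! p hp using h
  exact ⟨∑ i ∈ s, p i, fun x => by
    rw [map_sum]
    exact Finset.sum_congr rfl fun i hi => hp i hi x⟩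

theorem prod {s : Finset ι} {F : ι → (σ → k) → k} (h : ∀ i ∈ s, IsPolyFun (F i)) :
    IsPolyFun fun x => ∏ i ∈ s, F i x := by
  choose! p hp using h
  exact ⟨∏ i ∈ s, p i, fun x => by
    rw [map_prod]
    exact Finset.prod_congr rfl fun i hi => hp i hi x⟩

theorem ite {P : Prop} [Decidable P] (hf : IsPolyFun f) (hg : IsPolyFun g) :
    IsPolyFun fun x => if P then f x else g x := by
  split_ifs <;> assumption

theorem det [Fintype ι] [DecidableEq ι] {M : (σ → k) → Matrix ι ι k}
    (h : ∀ i j, IsPolyFun fun x => M x i j) : IsPolyFun fun x => (M x).det := by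
  simp only [Matrix.det_apply']
  exact sum fun π _ => (const _).mul (prod fun i _ => h _ _)

theorem eval {w : (σ → k) → τ → k} (hw : ∀ t, IsPolyFun fun x => w x t) (p : MvPolynomial τ k) :
    IsPolyFun fun x => MvPolynomial.eval (w x) p := by
  choose r hr using hw
  refine ⟨MvPolynomial.bind₁ r p, fun x => ?_⟩
  have h := MvPolynomial.aeval_bind₁ (S := k) x r p
  simp only [MvPolynomial.aeval_eq_eval] at h
  change MvPolynomial.eval (w x) p = _
  rw [h, show w x = fun t => MvPolynomial.eval x (r t) from funext fun t => hr t x]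

theorem comp {f : (τ → k) → k} (hf : IsPolyFun f) {w : (σ → k) → τ → k}
    (hw : ∀ t, IsPolyFun fun x => w x t) : IsPolyFun fun x => f (w x) := by
  obtain ⟨p, hp⟩ := hf
  simp only [hp]
  exact eval hw p

theorem linear [Finite σ] (φ : (σ → k) →ₗ[k] k) : IsPolyFun fun x => φ x := by
  classical
  have := Fintype.ofFinite σ
  have h : ∀ x, φ x = ∑ s, x s * φ (Pi.single s 1) := fun x => by
    conv_lhs => rw [pi_eq_sum_univ' x, map_sum]
    simp only [map_smul, smul_eq_mul]
  rw [funext h]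
  exact sum fun s _ => (coord s).mul (const _)

/-- The density of a nonempty principal open subset of affine space, in the form used throughout: an
identity known where `g ≠ 0` holds everywhere. Over an infinite field polynomial functions form a
domain. -/
theorem eq_zero_of_mul [Infinite k] (hf : IsPolyFun f) (hg : IsPolyFun g) (h : ∀ x, f x * g x = 0)
    {x₀ : σ → k} (hx₀ : g x₀ ≠ 0) (x : σ → k) : f x = 0 := by
  obtain ⟨p, hp⟩ := hf
  obtain ⟨r, hr⟩ := hg
  have h1 : p * r = 0 := MvPolynomial.funext fun x => by rw [map_mul, ← hp, ← hr, h, map_zero]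
  rcases mul_eq_zero.1 h1 with h2 | h2
  · simp [hp, h2]
  · exact absurd (by simp [hr, h2]) hx₀

end IsPolyFun

/-- More polynomial functions than coordinates are algebraically dependent. -/
theorem exists_relation_of_card_lt {σ ν : Type*} [Fintype σ] [Fintype ν]
    (h : Fintype.card σ < Fintype.card ν) (y : ν → MvPolynomial σ k) :
    ∃ P : MvPolynomial ν k, P ≠ 0 ∧ MvPolynomial.aeval y P = 0 := by
  by_contra! hcon
  have hind : AlgebraicIndependent k y := by
    rw [algebraicIndependent_iff]
    intro p hp
    by_contra hp0
    exact hcon p hp0 hp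
  have h1 := hind.lift_cardinalMk_le_trdeg
  rw [MvPolynomial.trdeg_of_isDomain] at h1
  simp only [Cardinal.mk_fintype, Cardinal.lift_natCast, Nat.cast_le] at h1
  omega

/-- A family of functions on a variety that is parametrized by `k ^ σ × k ^ γ` is algebraically
dependent if there are more than `card σ + card γ - card ε` of them, where `k ^ ε` acts on the
parameters with generically finite stabilizers, without changing the point (up to the choice
of the second parameter). -/
theorem exists_relation_of_action [Infinite k] {σ γ ε ν : Type*} [Fintype σ] [Fintype γ]
    [Fintype ε] [Fintype ν] (Y : ν → (σ → k) → (γ → k) → k)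
    (hY : ∀ j, IsPolyFun fun x : σ ⊕ γ → k => Y j (x ∘ Sum.inl) (x ∘ Sum.inr))
    (act : (σ → k) → (ε → k) →ₗ[k] (σ → k)) (hact : ∀ a s, IsPolyFun fun v => act v a s)
    (τ : (ε → k) → k) (hτ : IsPolyFun τ) {a₁ : ε → k} (ha₁ : τ a₁ ≠ 0)
    (hinv : ∀ v a g, τ a ≠ 0 → ∃ g', ∀ j, Y j (act v a) g' = Y j v g)
    {v₀ : σ → k} (hv₀ : Function.Injective (act v₀))
    (hcard : Fintype.card σ + Fintype.card γ < Fintype.card ν + Fintype.card ε) :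
    ∃ Q : MvPolynomial ν k, Q ≠ 0 ∧ ∀ v g, MvPolynomial.eval (fun j => Y j v g) Q = 0 := by
  classical
  obtain ⟨ψ, hψ⟩ := LinearMap.exists_leftInverse_of_injective (act v₀)
    (LinearMap.ker_eq_bot.2 hv₀)
  choose y hy using hY
  choose z hz using fun t : ε => IsPolyFun.linear (LinearMap.proj t ∘ₗ ψ)
  -- The functions `Y` are supplemented by the linear functions `ψ`, which are coordinates along the
  -- orbit through `v₀`. Together there are too many to be independent.
  obtain ⟨P, hP, hP0⟩ := exists_relation_of_card_lt (σ := σ ⊕ γ) (ν := ε ⊕ ν)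
    (by simpa [add_comm (Fintype.card ε)] using hcard)
    (Sum.elim (fun t => MvPolynomial.rename Sum.inl (z t)) y)
  have hPe : ∀ v g, MvPolynomial.eval (Sum.elim (ψ v) fun j => Y j v g) P = 0 := by
    intro v g
    have h := congrArg (MvPolynomial.eval (Sum.elim v g)) hP0
    rw [MvPolynomial.aeval_eq_bind₁, map_zero] at h
    have h' := MvPolynomial.aeval_bind₁ (S := k) (Sum.elim v g)
      (Sum.elim (fun t => MvPolynomial.rename Sum.inl (z t)) y) P
    simp only [MvPolynomial.aeval_eq_eval] at h'
    rw [h'] at h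
    rw [← h]
    congr 2
    funext t
    rcases t with t | t
    · have := hz t v
      simp only [LinearMap.comp_apply, LinearMap.proj_apply] at this
      simp [MvPolynomial.eval_rename, this]
    · have := hy t (Sum.elim v g)
      simp only [Sum.elim_comp_inl, Sum.elim_comp_inr] at this
      simp [this]
  set P' := MvPolynomial.sumAlgEquiv k ε ν P with hP'
  have hP'0 : P' ≠ 0 := by simpa [hP'] using hP
  -- Along an orbit the `Y` are fixed while the orbit coordinates become arbitrary, so every
  -- coefficient of `P` in the orbit variables is a relation among the `Y` alone. Any nonzero one
  -- will do.
  obtain ⟨α, hα⟩ := MvPolynomial.ne_zero_iff.1 hP'0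
  refine ⟨MvPolynomial.coeff α P', hα, ?_⟩
  have hev : ∀ (c : ν → k) (Z : ε → k), MvPolynomial.eval Z (P'.map (MvPolynomial.eval c)) =
      MvPolynomial.eval (Sum.elim Z c) P := by
    intro c Z
    rw [MvPolynomial.eval_map, hP']
    have : ((MvPolynomial.eval₂Hom (MvPolynomial.eval c) Z).comp
        (MvPolynomial.sumAlgEquiv k ε ν : MvPolynomial (ε ⊕ ν) k →+* _)) =
        MvPolynomial.eval (Sum.elim Z c) := by
      ext t
      · simp
      · rcases t with t | t <;> simp
    exact DFunLike.congr_fun this P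
  -- Where `δ ≠ 0`, `ψ` maps the orbit directions at `v` onto `k ^ ε`. This holds at `v₀`, so on a
  -- dense set.
  set δ : (σ → k) → k := fun v => (LinearMap.toMatrix' (ψ ∘ₗ act v)).det with hδ
  have hδpoly : IsPolyFun δ := IsPolyFun.det fun i j => by
    simp only [LinearMap.toMatrix'_apply, LinearMap.comp_apply]
    exact (IsPolyFun.linear (LinearMap.proj i ∘ₗ ψ)).comp fun s => hact _ s
  have hδ0 : δ v₀ ≠ 0 := by simp [hδ, hψ]
  have hgood : ∀ v g, δ v ≠ 0 →
      MvPolynomial.eval (fun j => Y j v g) (MvPolynomial.coeff α P') = 0 := by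
    intro v g hv
    have h1 : ∀ a, MvPolynomial.eval (Sum.elim (ψ (act v a)) fun j => Y j v g) P * τ a = 0 := by
      intro a
      by_cases ha : τ a = 0
      · rw [ha, mul_zero]
      · obtain ⟨g', hg'⟩ := hinv v a g ha
        have := hPe (act v a) g'
        simp only [hg'] at this
        rw [this, zero_mul]
    -- Invariance is only available for `τ a ≠ 0`; density removes the restriction.
    have h2 : ∀ a, MvPolynomial.eval (Sum.elim (ψ (act v a)) fun j => Y j v g) P = 0 :=
      IsPolyFun.eq_zero_of_mul (IsPolyFun.eval (by
        rintro (t | t)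
        · exact IsPolyFun.linear (LinearMap.proj t ∘ₗ ψ ∘ₗ act v)
        · exact IsPolyFun.const _) P) hτ h1 ha₁
    have h3 : Function.Surjective (ψ ∘ₗ act v) := by
      rw [← LinearMap.range_eq_top, ← LinearMap.isUnit_iff_range_eq_top,
        LinearMap.isUnit_iff_isUnit_det, ← LinearMap.det_toMatrix', isUnit_iff_ne_zero]
      exact hv
    have h4 : P'.map (MvPolynomial.eval fun j => Y j v g) = 0 := by
      refine MvPolynomial.funext fun Z => ?_
      obtain ⟨a, rfl⟩ := h3 Z
      rw [hev, map_zero]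
      exact h2 a
    rw [← MvPolynomial.coeff_map, h4, MvPolynomial.coeff_zero]
  intro v g
  have h5 : IsPolyFun fun x : σ ⊕ γ → k =>
      MvPolynomial.eval (fun j => Y j (x ∘ Sum.inl) (x ∘ Sum.inr)) (MvPolynomial.coeff α P') :=
    IsPolyFun.eval (fun j => ⟨y j, hy j⟩) _
  have h6 : IsPolyFun fun x : σ ⊕ γ → k => δ (x ∘ Sum.inl) := hδpoly.comp fun s => IsPolyFun.coord _
  have h7 := IsPolyFun.eq_zero_of_mul h5 h6 (fun x => by
    by_cases hx : δ (x ∘ Sum.inl) = 0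
    · rw [hx, mul_zero]
    · rw [hgood _ _ hx, zero_mul]) (x₀ := Sum.elim v₀ 0) (by simpa using hδ0) (Sum.elim v g)
  simpa using h7

end IsPolyFun

/-! ### Vanishing ideals of subsets of quiver Grassmannians -/

section AlgIndepMod

variable {k R : Type*} [Field k] [CommRing R] [Algebra k R]

/-- Algebraic independence modulo an ideal. -/
def AlgIndepMod {ν : Type*} (P : Ideal R) (y : ν → R) : Prop :=
  ∀ Q : MvPolynomial ν k, MvPolynomial.aeval y Q ∈ P → Q = 0

/-- A strict inclusion of ideals with the smaller one prime raises the transcendence degree. From a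
relation modulo `P`, cancel the highest power of the variable of `f`, using `f ∉ P`. Modulo `P'`,
where `f` vanishes, the constant term of the rest is a relation among the `y`, hence zero, so one
more power would divide. -/
theorem AlgIndepMod.option {ν : Type*} {P P' : Ideal R} [P.IsPrime] (hP : P ≤ P') {y : ν → R}
    (hy : AlgIndepMod (k := k) P' y) {f : R} (hf : f ∈ P') (hf' : f ∉ P) :
    AlgIndepMod (k := k) P (fun o : Option ν => o.elim f y) := by
  have key : ∀ (Q : Polynomial (MvPolynomial ν k)),
      Polynomial.eval₂ (MvPolynomial.aeval y).toRingHom f Q ∈ P → Q = 0 := by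
    intro Q hQ
    by_contra hQ0
    obtain ⟨Q', hQ', hdvd⟩ := Polynomial.exists_eq_pow_rootMultiplicity_mul_and_not_dvd Q hQ0 0
    rw [hQ', Polynomial.eval₂_mul, Polynomial.eval₂_pow] at hQ
    simp only [Polynomial.eval₂_X, map_zero, sub_zero] at hQ hdvd
    have h1 := (Ideal.IsPrime.mem_or_mem ‹_› hQ).resolve_left
      fun h => hf' (Ideal.IsPrime.mem_of_pow_mem ‹_› _ h)
    have h2 : MvPolynomial.aeval y (Q'.coeff 0) ∈ P' := by
      have h3 := Polynomial.divX_mul_X_add Q'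
      rw [← h3, Polynomial.eval₂_add, Polynomial.eval₂_mul, Polynomial.eval₂_X,
        Polynomial.eval₂_C] at h1
      exact (Ideal.add_mem_iff_right _ (Ideal.mul_mem_left _ _ hf)).1 (hP h1)
    exact hdvd (Polynomial.X_dvd_iff.2 (hy _ h2))
  intro Q hQ
  have h := key (MvPolynomial.optionEquivLeft k ν Q) (by
    convert hQ using 1
    have : (Polynomial.eval₂RingHom (MvPolynomial.aeval y).toRingHom f).comp
        (MvPolynomial.optionEquivLeft k ν).toAlgHom.toRingHom =
        (MvPolynomial.aeval (fun o : Option ν => o.elim f y)).toRingHom := by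
      refine MvPolynomial.ringHom_ext (fun c => ?_) fun o => ?_
      · simp
      · rcases o with _ | o <;> simp
    exact DFunLike.congr_fun this Q)
  simpa using h

end AlgIndepMod

/-! ### Frames and base change over the product of Grassmannians -/

section Frames

universe w u q

variable {k : Type u} [Field k] {I : Type q} {V : I → Type w} [∀ i, AddCommGroup (V i)]
  [∀ i, Module k (V i)] {e : I → ℕ}

/-- Coordinates of tuples of square matrices. -/
abbrev BaseChange (e : I → ℕ) : Type _ := Σ i, Fin (e i) × Fin (e i)

/-- The action of tuples of square matrices on tuples of families of vectors. -/
def baseChange (g : BaseChange e → k) :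
    (∀ i, Fin (e i) → V i) →ₗ[k] (∀ i, Fin (e i) → V i) where
  toFun F i t := ∑ s, g ⟨i, s, t⟩ • F i s
  map_add' F F' := by
    ext i t
    simp [Finset.sum_add_distrib]
  map_smul' c F := by
    ext i t
    simp [Finset.smul_sum, smul_comm c]

/-- The matrices of a tuple of matrices. -/
def baseChangeMatrix (g : BaseChange e → k) (i : I) : Matrix (Fin (e i)) (Fin (e i)) k :=
  Matrix.of fun s t => g ⟨i, s, t⟩

/-- The tuple of identity matrices. -/
def idBaseChange : BaseChange e → k := fun x => if x.2.1 = x.2.2 then 1 else 0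

theorem baseChangeMatrix_id (i : I) : baseChangeMatrix (idBaseChange (k := k) (e := e)) i = 1 := by
  ext s t
  simp [baseChangeMatrix, idBaseChange, Matrix.one_apply]

theorem baseChange_id (F : ∀ i, Fin (e i) → V i) : baseChange (k := k) idBaseChange F = F := by
  ext i t
  simp [baseChange, idBaseChange, ite_smul]

theorem linearIndependent_baseChange (F : MultiFrame k V e) {g : BaseChange e → k}
    (hg : ∀ i, (baseChangeMatrix g i).det ≠ 0) (i : I) :
    LinearIndependent k (baseChange g F.1 i) := by
  have h := F.2 i
  rw [Fintype.linearIndependent_iff] at h ⊢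
  intro c hc
  have h1 : ∑ s, ((baseChangeMatrix g i).mulVec c) s • F.1 i s = 0 := by
    rw [← hc]
    simp only [baseChange, LinearMap.coe_mk, AddHom.coe_mk, Matrix.mulVec, dotProduct,
      baseChangeMatrix, Matrix.of_apply, Finset.sum_smul, Finset.smul_sum, smul_smul]
    rw [Finset.sum_comm]
    simp only [mul_comm]
  have h2 : (baseChangeMatrix g i).mulVec c = 0 := funext fun s => h _ h1 s
  have h3 := Matrix.eq_zero_of_mulVec_eq_zero (hg i) h2
  exact fun t => congrFun h3 t

/-- The frame obtained by an invertible base change. -/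
def MultiFrame.baseChange (F : MultiFrame k V e) {g : BaseChange e → k}
    (hg : ∀ i, (baseChangeMatrix g i).det ≠ 0) : MultiFrame k V e :=
  ⟨_root_.baseChange g F.1, linearIndependent_baseChange F hg⟩

theorem MultiFrame.span_eq_iff {F F' : MultiFrame k V e} : F.span = F'.span ↔
    ∀ i, Submodule.span k (Set.range (F.1 i)) = Submodule.span k (Set.range (F'.1 i)) :=
  ⟨fun h i => congrFun (congrArg Subtype.val h) i, fun h => Subtype.ext (funext h)⟩

theorem MultiFrame.span_baseChange (F : MultiFrame k V e) {g : BaseChange e → k}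
    (hg : ∀ i, (baseChangeMatrix g i).det ≠ 0) : (F.baseChange hg).span = F.span := by
  rw [MultiFrame.span_eq_iff]
  intro i
  have := FiniteDimensional.span_of_finite k (Set.finite_range (F.1 i))
  refine Submodule.eq_of_le_of_finrank_eq ?_ ?_
  · rw [Submodule.span_le]
    rintro _ ⟨t, rfl⟩
    change ∑ s, g ⟨i, s, t⟩ • F.1 i s ∈ Submodule.span k (Set.range (F.1 i))
    exact Submodule.sum_mem _ fun s _ =>
      Submodule.smul_mem _ _ (Submodule.subset_span (Set.mem_range_self s))
  · rw [finrank_span_eq_card ((F.baseChange hg).2 i), finrank_span_eq_card (F.2 i)]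

/-- With `span_baseChange`, this identifies the fibers of `span` with the orbits of the base change
group. A kernel vector of a transition matrix would be a linear relation in the frame `F'`. -/
theorem MultiFrame.exists_baseChange_of_span_eq {F F' : MultiFrame k V e}
    (h : F'.span = F.span) : ∃ (g : BaseChange e → k)
    (hg : ∀ i, (baseChangeMatrix g i).det ≠ 0), F' = F.baseChange hg := by
  rw [MultiFrame.span_eq_iff] at h
  have h1 : ∀ i t, ∃ c : Fin (e i) → k, ∑ s, c s • F.1 i s = F'.1 i t := by
    intro i t
    rw [← Submodule.mem_span_range_iff_exists_fun, ← h i]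
    exact Submodule.subset_span (Set.mem_range_self t)
  choose c hc using h1
  have hF : F'.1 = _root_.baseChange (fun x : BaseChange e => c x.1 x.2.2 x.2.1) F.1 := by
    ext i t
    exact (hc i t).symm
  refine ⟨fun x => c x.1 x.2.2 x.2.1, fun i hdet => ?_, Subtype.ext hF⟩
  obtain ⟨x, hx, hx0⟩ := Matrix.exists_mulVec_eq_zero_iff.2 hdet
  apply hx
  have h2 := F'.2 i
  rw [Fintype.linearIndependent_iff] at h2
  funext t
  refine h2 x ?_ t
  rw [hF]
  have h3 : ∑ s, ((baseChangeMatrix (fun x : BaseChange e => c x.1 x.2.2 x.2.1) i).mulVec x) s •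
      F.1 i s = 0 := by simp [hx0]
  rw [← h3]
  simp only [_root_.baseChange, LinearMap.coe_mk, AddHom.coe_mk, Matrix.mulVec, dotProduct,
    baseChangeMatrix, Matrix.of_apply, Finset.sum_smul, Finset.smul_sum, smul_smul]
  rw [Finset.sum_comm]
  simp only [mul_comm]

theorem exists_linearIndependent_span_eq {E : Type*} [AddCommGroup E] [Module k E] {m : ℕ}
    {U : Submodule k E} (hU : FiniteDimensional k U) (hm : Module.finrank k U = m) :
    ∃ f : Fin m → E, LinearIndependent k f ∧ Submodule.span k (Set.range f) = U := by
  let b := Module.finBasisOfFinrankEq k U hm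
  refine ⟨U.subtype ∘ b, b.linearIndependent.map' _ (Submodule.ker_subtype _), ?_⟩
  rw [Set.range_comp, Submodule.span_image, b.span_eq, Submodule.map_top, Submodule.range_subtype]

theorem MultiGrassmannian.exists_frame (U : MultiGrassmannian k V e) :
    ∃ F : MultiFrame k V e, F.span = U := by
  have h : ∀ i, ∃ f : Fin (e i) → V i, LinearIndependent k f ∧
      Submodule.span k (Set.range f) = U.1 i :=
    fun i => exists_linearIndependent_span_eq (U.2 i).1 (U.2 i).2
  choose f hf hf' using h
  exact ⟨⟨f, hf⟩, Subtype.ext (funext hf')⟩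

/-- The value of a polynomial at a tuple of families of vectors. -/
noncomputable def evalFrame (F : ∀ i, Fin (e i) → V i) :
    MvPolynomial (Module.Dual k (∀ i, Fin (e i) → V i)) k →+* k :=
  MvPolynomial.eval fun φ => φ F

theorem evalFrame_baseChange (g : BaseChange e → k) (F : ∀ i, Fin (e i) → V i)
    (p : MvPolynomial (Module.Dual k (∀ i, Fin (e i) → V i)) k) :
    evalFrame (baseChange g F) p =
      evalFrame F (MvPolynomial.rename (fun φ => φ ∘ₗ baseChange g) p) := by
  rw [evalFrame, evalFrame, MvPolynomial.eval_rename]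
  rfl

theorem isPolyFun_evalFrame_baseChange [Finite I] (F : ∀ i, Fin (e i) → V i)
    (p : MvPolynomial (Module.Dual k (∀ i, Fin (e i) → V i)) k) :
    IsPolyFun fun g : BaseChange e → k => evalFrame (baseChange g F) p := by
  refine IsPolyFun.eval (w := fun g (φ : Module.Dual k (∀ i, Fin (e i) → V i)) =>
    φ (baseChange g F)) (fun φ => ?_) p
  let ψ : (BaseChange e → k) →ₗ[k] (∀ i, Fin (e i) → V i) :=
    { toFun g := baseChange g F
      map_add' g g' := by
        ext i t
        simp [baseChange, add_smul, Finset.sum_add_distrib]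
      map_smul' c g := by
        ext i t
        simp [baseChange, Finset.smul_sum, smul_smul] }
  exact IsPolyFun.linear (φ ∘ₗ ψ)

theorem isPolyFun_prod_det [Fintype I] :
    IsPolyFun fun g : BaseChange e → k => ∏ i, (baseChangeMatrix g i).det :=
  IsPolyFun.prod fun i _ => IsPolyFun.det fun s t => IsPolyFun.coord (⟨i, s, t⟩ : BaseChange e)

theorem MultiFrame.isClosed_iff {A : Set (MultiFrame k V e)} : IsClosed A ↔
    ∃ S : Set (MvPolynomial (Module.Dual k (∀ i, Fin (e i) → V i)) k),
      ∀ F, F ∈ A ↔ ∀ p ∈ S, evalFrame F.1 p = 0 := by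
  let := zariskiTopology k (∀ i, Fin (e i) → V i)
  refine isClosed_induced_iff.trans ⟨?_, ?_⟩
  · rintro ⟨D, hD, rfl⟩
    rw [← isOpen_compl_iff] at hD
    obtain ⟨S, hS⟩ := hD
    rw [compl_compl] at hS
    refine ⟨S, fun F => ?_⟩
    change F.1 ∈ D ↔ _
    rw [hS]
    rfl
  · rintro ⟨S, hS⟩
    refine ⟨{w | ∀ p ∈ S, MvPolynomial.eval (fun φ : Module.Dual k _ => φ w) p = 0}, ?_, ?_⟩
    · rw [← isOpen_compl_iff]
      exact ⟨S, by rw [compl_compl]⟩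
    · ext F
      exact (hS F).symm

theorem MultiGrassmannian.isClosed_iff {C : Set (MultiGrassmannian k V e)} : IsClosed C ↔
    ∃ S : Set (MvPolynomial (Module.Dual k (∀ i, Fin (e i) → V i)) k),
      ∀ F : MultiFrame k V e, F.span ∈ C ↔ ∀ p ∈ S, evalFrame F.1 p = 0 :=
  isClosed_coinduced.trans MultiFrame.isClosed_iff

end Frames

/-! ### From chains of irreducible closed sets to independent functions on frames -/

namespace QuiverRep.Grassmannian

universe w u v q

variable {k : Type u} [Field k] {Q : Type q} [Quiver.{v} Q] {R : QuiverRep.{w} k Q} {e : Q → ℕ}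

theorem isClosed_iff {Z : Set (R.Grassmannian e)} : IsClosed Z ↔
    ∃ C : Set (MultiGrassmannian k R.V e),
      (∃ S : Set (MvPolynomial (Module.Dual k (∀ i, Fin (e i) → R.V i)) k),
        ∀ F : MultiFrame k R.V e, F.span ∈ C ↔ ∀ p ∈ S, evalFrame F.1 p = 0) ∧
      ∀ U : R.Grassmannian e, U ∈ Z ↔ U.1 ∈ C := by
  rw [isClosed_induced_iff]
  refine exists_congr fun C => and_congr MultiGrassmannian.isClosed_iff ?_
  rw [Set.ext_iff]
  exact forall_congr' fun U => iff_comm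

/-- The points over which a polynomial in frames vanishes. -/
def zeroFibers (p : MvPolynomial (Module.Dual k (∀ i, Fin (e i) → R.V i)) k) :
    Set (R.Grassmannian e) :=
  {U | ∀ F : MultiFrame k R.V e, F.span = U.1 → evalFrame F.1 p = 0}

/-- Vanishing of `p` on a whole fiber means that all translates of `p` by invertible base changes
vanish at a single frame of it, and these are polynomial conditions. -/
theorem isClosed_zeroFibers (p : MvPolynomial (Module.Dual k (∀ i, Fin (e i) → R.V i)) k) :
    IsClosed (zeroFibers (R := R) (e := e) p) := by
  rw [isClosed_iff]
  refine ⟨{U | ∀ F : MultiFrame k R.V e, F.span = U → evalFrame F.1 p = 0},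
    ⟨{r | ∃ g : BaseChange e → k, (∀ i, (baseChangeMatrix g i).det ≠ 0) ∧
      r = MvPolynomial.rename (fun φ => φ ∘ₗ baseChange g) p}, fun F => ?_⟩, fun U => Iff.rfl⟩
  constructor
  · rintro h _ ⟨g, hg, rfl⟩
    rw [← evalFrame_baseChange]
    exact h (F.baseChange hg) (F.span_baseChange hg)
  · rintro h F' hF'
    obtain ⟨g, hg, rfl⟩ := MultiFrame.exists_baseChange_of_span_eq hF'
    exact (evalFrame_baseChange g F.1 p).trans (h _ ⟨g, hg, rfl⟩)

/-- The polynomials in frames that vanish on all frames of points of a set. -/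
def vanishingIdeal (Z : Set (R.Grassmannian e)) :
    Ideal (MvPolynomial (Module.Dual k (∀ i, Fin (e i) → R.V i)) k) where
  carrier := {p | ∀ U ∈ Z, ∀ F : MultiFrame k R.V e, F.span = U.1 → evalFrame F.1 p = 0}
  add_mem' h h' U hU F hF := by rw [map_add, h U hU F hF, h' U hU F hF, add_zero]
  zero_mem' U hU F hF := map_zero _
  smul_mem' c p h U hU F hF := by rw [smul_eq_mul, map_mul, h U hU F hF, mul_zero]

theorem mem_vanishingIdeal_iff {Z : Set (R.Grassmannian e)}
    {p : MvPolynomial (Module.Dual k (∀ i, Fin (e i) → R.V i)) k} :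
    p ∈ vanishingIdeal Z ↔ Z ⊆ zeroFibers p := Iff.rfl

/-- The equations that cut out the closed set `Z` lie in its ideal; if they also lay in the ideal of
`Z'`, then `Z' ⊆ Z`. -/
theorem vanishingIdeal_lt {Z Z' : Set (R.Grassmannian e)} (hZ : IsClosed Z) (h : Z ⊂ Z') :
    vanishingIdeal Z' < vanishingIdeal Z := by
  refine lt_of_le_not_ge (fun p hp U hU => hp U (h.1 hU)) fun hle => h.2 fun U hU => ?_
  obtain ⟨C, ⟨S, hS⟩, hC⟩ := isClosed_iff.1 hZ
  obtain ⟨F, hF⟩ := MultiGrassmannian.exists_frame U.1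
  rw [hC, ← hF, hS]
  intro p hp
  refine hle (show p ∈ vanishingIdeal Z from fun U' hU' F' hF' => ?_) U hU F hF
  rw [hC, ← hF', hS] at hU'
  exact hU' p hp

variable [Fintype Q] [Infinite k]

/-- Irreducibility of the base and of the fibers combine. Each fiber is a copy of a product of
general linear groups, so if `p r` vanishes on it, one of `p`, `r` vanishes on all of it. Thus `Z`
is covered by two closed sets. -/
theorem isPrime_vanishingIdeal {Z : Set (R.Grassmannian e)} (hZ : IsIrreducible Z) :
    (vanishingIdeal Z).IsPrime := by
  refine ⟨fun h => ?_, fun {p r} hpr => ?_⟩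
  · obtain ⟨U, hU⟩ := hZ.1
    obtain ⟨F, hF⟩ := MultiGrassmannian.exists_frame U.1
    have := (Ideal.eq_top_iff_one _).1 h U hU F hF
    simp at this
  · rw [mem_vanishingIdeal_iff, mem_vanishingIdeal_iff]
    refine (isPreirreducible_iff_isClosed_union_isClosed.1 hZ.2) _ _ (isClosed_zeroFibers p)
      (isClosed_zeroFibers r) fun U hU => ?_
    rw [Set.mem_union, or_iff_not_imp_left]
    intro hp F' hF'
    simp only [zeroFibers, Set.mem_ofPred_eq, not_forall] at hp
    obtain ⟨F, hF, hFp⟩ := hp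
    obtain ⟨g, hg, rfl⟩ := MultiFrame.exists_baseChange_of_span_eq (hF'.trans hF.symm)
    -- The determinant factor extends the identity from invertible base changes to all tuples of
    -- matrices.
    refine IsPolyFun.eq_zero_of_mul (isPolyFun_evalFrame_baseChange F.1 r)
      ((isPolyFun_evalFrame_baseChange F.1 p).mul isPolyFun_prod_det) (fun g => ?_)
      (x₀ := idBaseChange) ?_ g
    · by_cases hg : ∀ i, (baseChangeMatrix g i).det ≠ 0
      · have := hpr U hU (F.baseChange hg) ((F.span_baseChange hg).trans hF)
        rw [map_mul] at this
        change evalFrame (baseChange g F.1) p * evalFrame (baseChange g F.1) r = 0 at this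
        linear_combination (∏ i, (baseChangeMatrix g i).det) * this
      · push Not at hg
        obtain ⟨i, hi⟩ := hg
        rw [Finset.prod_eq_zero (Finset.mem_univ i) hi, mul_zero, mul_zero]
    · simpa [baseChangeMatrix_id, baseChange_id] using hFp

/-- The coordinates on the fiber of frames over a point are algebraically independent. -/
theorem exists_algIndepMod_of_nonempty {Z : Set (R.Grassmannian e)} (hZ : Z.Nonempty) :
    ∃ z : BaseChange e → MvPolynomial (Module.Dual k (∀ i, Fin (e i) → R.V i)) k,
      AlgIndepMod (k := k) (vanishingIdeal Z) z := by
  classical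
  obtain ⟨U, hU⟩ := hZ
  obtain ⟨F, hF⟩ := MultiGrassmannian.exists_frame U.1
  have h : ∀ i, ∃ ξ : R.V i →ₗ[k] (Fin (e i) → k), ∀ s, ξ (F.1 i s) = Pi.single s 1 := by
    intro i
    obtain ⟨ξ, hξ⟩ := LinearMap.exists_leftInverse_of_injective
      (Fintype.linearCombination k (F.1 i)) (LinearMap.ker_eq_bot.2
        (linearIndependent_iff_injective_fintypeLinearCombination.1 (F.2 i)))
    refine ⟨ξ, fun s => ?_⟩
    have := LinearMap.congr_fun hξ (Pi.single s 1)
    simpa [Fintype.linearCombination_apply_single] using this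
  choose ξ hξ using h
  -- As `ξ` is dual to the frame `F`, these linear forms read off the entries of `g` at the frame
  -- `F` changed by `g`.
  refine ⟨fun x => MvPolynomial.X
    (LinearMap.proj x.2.1 ∘ₗ ξ x.1 ∘ₗ LinearMap.proj x.2.2 ∘ₗ LinearMap.proj x.1), fun P hP => ?_⟩
  have h1 : ∀ g : BaseChange e → k, MvPolynomial.eval g P * ∏ i, (baseChangeMatrix g i).det = 0 := by
    intro g
    by_cases hg : ∀ i, (baseChangeMatrix g i).det ≠ 0
    · have := hP U hU (F.baseChange hg) ((F.span_baseChange hg).trans hF)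
      rw [MvPolynomial.aeval_eq_bind₁, evalFrame] at this
      have h' := MvPolynomial.aeval_bind₁ (S := k) (fun φ => φ (F.baseChange hg).1)
        (fun x : BaseChange e => MvPolynomial.X (R := k)
          (LinearMap.proj x.2.1 ∘ₗ ξ x.1 ∘ₗ LinearMap.proj x.2.2 ∘ₗ LinearMap.proj x.1 :
            Module.Dual k (∀ i, Fin (e i) → R.V i))) P
      simp only [MvPolynomial.aeval_eq_eval] at h'
      rw [h'] at this
      have h2 : (fun x : BaseChange e => MvPolynomial.eval
          (fun φ : Module.Dual k (∀ i, Fin (e i) → R.V i) => φ (F.baseChange hg).1)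
          (MvPolynomial.X (R := k) (LinearMap.proj x.2.1 ∘ₗ ξ x.1 ∘ₗ LinearMap.proj x.2.2 ∘ₗ
            LinearMap.proj x.1 : Module.Dual k (∀ i, Fin (e i) → R.V i)))) = g := by
        funext ⟨i, s, t⟩
        simp [MultiFrame.baseChange, baseChange, hξ, Pi.single_apply]
      rw [h2] at this
      rw [this, zero_mul]
    · push Not at hg
      obtain ⟨i, hi⟩ := hg
      rw [Finset.prod_eq_zero (Finset.mem_univ i) hi, mul_zero]
  refine MvPolynomial.funext fun g => ?_
  rw [map_zero]
  refine IsPolyFun.eq_zero_of_mul ⟨P, fun _ => rfl⟩ isPolyFun_prod_det h1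
    (x₀ := idBaseChange) ?_ g
  simp [baseChangeMatrix_id]

/-- A chain of irreducible closed subsets yields polynomials in frames that are algebraically
independent as functions on the frames of points of the Grassmannian. -/
theorem exists_algIndep_of_chain (c : LTSeries (TopologicalSpace.IrreducibleCloseds
    (R.Grassmannian e))) : ∃ (ν : Type q) (_ : Fintype ν)
      (y : ν → MvPolynomial (Module.Dual k (∀ i, Fin (e i) → R.V i)) k),
      Fintype.card ν = c.length + Fintype.card (BaseChange e) ∧
      AlgIndepMod (k := k) (vanishingIdeal (Set.univ : Set (R.Grassmannian e))) y := by
  have key : ∀ l (hl : l < c.length + 1), ∃ (ν : Type q) (_ : Fintype ν)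
      (y : ν → MvPolynomial (Module.Dual k (∀ i, Fin (e i) → R.V i)) k),
      Fintype.card ν = l + Fintype.card (BaseChange e) ∧
      AlgIndepMod (k := k) (vanishingIdeal (c ⟨l, hl⟩ : Set (R.Grassmannian e))) y := by
    intro l
    induction l with
    | zero =>
      intro hl
      obtain ⟨z, hz⟩ := exists_algIndepMod_of_nonempty (c ⟨0, hl⟩).isIrreducible'.1
      exact ⟨BaseChange e, inferInstance, z, by simp, hz⟩
    | succ l ih =>
      intro hl
      obtain ⟨ν, hν, y, hcard, hy⟩ := ih (by omega)
      have hlt : (c ⟨l, by omega⟩ : Set (R.Grassmannian e)) ⊂ c ⟨l + 1, hl⟩ :=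
        SetLike.coe_ssubset_coe.2 (c.strictMono (by simp [Fin.lt_def]))
      have h := vanishingIdeal_lt (c ⟨l, by omega⟩).isClosed' hlt
      -- Each strict inclusion contributes one new independent function, one that vanishes on the
      -- smaller set but not on the larger.
      obtain ⟨f, hf, hf'⟩ := SetLike.exists_of_lt h
      have := isPrime_vanishingIdeal (c ⟨l + 1, hl⟩).isIrreducible'
      refine ⟨Option ν, inferInstance, _, ?_, hy.option h.le hf hf'⟩
      rw [Fintype.card_option, hcard]
      omega
  obtain ⟨ν, hν, y, hcard, hy⟩ := key c.length (by omega)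
  exact ⟨ν, hν, y, hcard, fun P hP => hy P fun U _ => hP U (Set.mem_univ U)⟩

end QuiverRep.Grassmannian

/-! ### Generators of nilpotent representations of the cycle -/

section Generators

variable {k : Type*} [Field k] {E : Type*} [AddCommGroup E] [Module k E]

theorem finrank_map_add_finrank_inf_ker (A : E →ₗ[k] E) (W : Submodule k E)
    [FiniteDimensional k W] :
    Module.finrank k (W.map A) + Module.finrank k (W ⊓ LinearMap.ker A : Submodule k E) =
      Module.finrank k W := by
  have h := LinearMap.finrank_range_add_finrank_ker (A.domRestrict W)
  rw [LinearMap.range_domRestrict, LinearMap.ker_domRestrict] at h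
  rw [← h, ← Submodule.finrank_map_subtype_eq W (Submodule.comap W.subtype (LinearMap.ker A)),
    Submodule.map_comap_subtype]

theorem exists_generators_of_le {W V : Submodule k E} [FiniteDimensional k V] (h : W ≤ V) :
    ∃ f : Fin (Module.finrank k V - Module.finrank k W) → E, (∀ t, f t ∈ V) ∧
      V ≤ W ⊔ Submodule.span k (Set.range f) := by
  obtain ⟨C, hC⟩ := W.exists_isCompl
  have hW : FiniteDimensional k W := Submodule.finiteDimensional_of_le h
  have h1 : W ⊔ C ⊓ V = V := by rw [← sup_inf_assoc_of_le C h, hC.sup_eq_top, top_inf_eq]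
  have h2 : W ⊓ (C ⊓ V) = ⊥ := by rw [← inf_assoc, hC.inf_eq_bot, bot_inf_eq]
  have hCV : FiniteDimensional k (C ⊓ V : Submodule k E) :=
    Submodule.finiteDimensional_of_le inf_le_right
  have h3 := Submodule.finrank_sup_add_finrank_inf_eq W (C ⊓ V)
  rw [h1, h2, finrank_bot, add_zero] at h3
  obtain ⟨f, -, hf⟩ := exists_linearIndependent_span_eq hCV
    (show Module.finrank k (C ⊓ V : Submodule k E) =
      Module.finrank k V - Module.finrank k W by omega)
  refine ⟨f, fun t => ?_, by rw [hf, h1]⟩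
  have := Submodule.subset_span (R := k) (Set.mem_range_self (f := f) t)
  rw [hf] at this
  exact this.2

variable {n : ℕ} (A : E →ₗ[k] E) (U : ZMod n → Submodule k E)

/-- The part of a graded subspace that is killed by a power of an endomorphism. -/
def socLayer (i : ZMod n) (s : ℕ) : Submodule k E := U i ⊓ LinearMap.ker (A ^ s)

variable {A U}

theorem mem_socLayer {i : ZMod n} {s : ℕ} {x : E} :
    x ∈ socLayer A U i s ↔ x ∈ U i ∧ (A ^ s) x = 0 := Iff.rfl

instance [h : ∀ i, FiniteDimensional k (U i)] (i : ZMod n) (s : ℕ) :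
    FiniteDimensional k (socLayer A U i s) :=
  Submodule.finiteDimensional_of_le inf_le_left

theorem pow_apply_eq_zero_of_le {s t : ℕ} (h : s ≤ t) {x : E} (hx : (A ^ s) x = 0) :
    (A ^ t) x = 0 := by
  rw [← Nat.sub_add_cancel h, pow_add, Module.End.mul_apply, hx, map_zero]

theorem map_sup_socLayer_le (hA : ∀ i, (U i).map A ≤ U (i + 1)) (i : ZMod n) (s : ℕ) :
    (socLayer A U i (s + 2)).map A ⊔ socLayer A U (i + 1) s ≤ socLayer A U (i + 1) (s + 1) := by
  refine sup_le ?_ fun x hx => ⟨hx.1, pow_apply_eq_zero_of_le (Nat.le_succ s) hx.2⟩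
  rintro _ ⟨y, hy, rfl⟩
  refine ⟨hA i ⟨y, hy.1, rfl⟩, ?_⟩
  change (A ^ (s + 1)) (A y) = 0
  rw [← Module.End.mul_apply, ← pow_succ]
  exact hy.2

/-- The intersection of the two summands is the image under `A` of the kernel of `A ^ (s + 1)`. On
both layers `A` has the same kernel in `U i`, so its contribution cancels and only layer dimensions
remain. -/
theorem finrank_map_sup_socLayer [∀ i, FiniteDimensional k (U i)]
    (hA : ∀ i, (U i).map A ≤ U (i + 1)) (i : ZMod n) (s : ℕ) :
    Module.finrank k ((socLayer A U i (s + 2)).map A ⊔ socLayer A U (i + 1) s : Submodule k E) +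
        Module.finrank k (socLayer A U i (s + 1)) =
      Module.finrank k (socLayer A U i (s + 2)) + Module.finrank k (socLayer A U (i + 1) s) := by
  have h1 := Submodule.finrank_sup_add_finrank_inf_eq ((socLayer A U i (s + 2)).map A)
    (socLayer A U (i + 1) s)
  have h2 : (socLayer A U i (s + 2)).map A ⊓ socLayer A U (i + 1) s =
      (socLayer A U i (s + 1)).map A := by
    ext x
    constructor
    · rintro ⟨⟨y, hy, rfl⟩, hx⟩
      refine ⟨y, ⟨hy.1, ?_⟩, rfl⟩
      change (A ^ (s + 1)) y = 0
      rw [pow_succ]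
      exact hx.2
    · rintro ⟨y, hy, rfl⟩
      refine ⟨⟨y, ⟨hy.1, pow_apply_eq_zero_of_le (Nat.le_succ _) hy.2⟩, rfl⟩,
        hA i ⟨y, hy.1, rfl⟩, ?_⟩
      have : (A ^ (s + 1)) y = 0 := hy.2
      rwa [pow_succ] at this
  have h3 : ∀ t, socLayer A U i (t + 1) ⊓ LinearMap.ker A = socLayer A U i 1 := by
    intro t
    ext x
    simp only [Submodule.mem_inf, mem_socLayer, pow_one, LinearMap.mem_ker]
    refine ⟨fun h => ⟨h.1.1, h.2⟩, fun h => ⟨⟨h.1, ?_⟩, h.2⟩⟩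
    exact pow_apply_eq_zero_of_le (s := 1) (by omega) (by simpa using h.2)
  have h4 := finrank_map_add_finrank_inf_ker A (socLayer A U i (s + 2))
  have h5 := finrank_map_add_finrank_inf_ker A (socLayer A U i (s + 1))
  rw [h3] at h4 h5
  rw [h2] at h1
  omega

/-- A type of arcs with `c (i, s)` arcs of length `s + 1` that start at `i`. -/
abbrev ArcType {N : ℕ} (c : ZMod n × Fin N → ℕ) : Type := Σ x, Fin (c x)

/-- The start vertex of an arc. -/
abbrev ArcType.start {N : ℕ} {c : ZMod n × Fin N → ℕ} (g : ArcType c) : ZMod n := g.1.1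

/-- The length of an arc. -/
abbrev ArcType.length {N : ℕ} {c : ZMod n × Fin N → ℕ} (g : ArcType c) : ℕ := g.1.2 + 1

/-- The point at position `r` of an arc lies over `i` exactly if the arc starts at `i - r`, and such
a point exists if the length `s + 1` exceeds `r`. -/
theorem card_arcType [NeZero n] {N : ℕ} (c : ZMod n × Fin N → ℕ) (i : ZMod n) :
    (Finset.univ.filter fun x : ArcPoint (ArcType.length (c := c)) =>
      arcVertex ArcType.start ArcType.length x = i).card =
      ∑ r ∈ Finset.range N, ∑ s : Fin N, if r ≤ s then c (i - r, s) else 0 := by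
  rw [Finset.card_filter, Fintype.sum_sigma, Fintype.sum_sigma, Fintype.sum_prod_type_right,
    Finset.sum_comm (s := Finset.range N)]
  refine Finset.sum_congr rfl fun s _ => ?_
  change (∑ x, ∑ _t : Fin (c (x, s)), ∑ r : Fin ((s : ℕ) + 1),
    if x + ((r : ℕ) : ZMod n) = i then 1 else 0) = _
  have h1 : ∀ x : ZMod n, (∑ r : Fin (s + 1), if x + ((r : ℕ) : ZMod n) = i then 1 else 0) =
      ∑ r ∈ Finset.range N, if r ≤ s then (if x = i - r then 1 else 0) else 0 := by
    intro x
    rw [Fin.sum_univ_eq_sum_range (fun r => if x + (r : ZMod n) = i then 1 else 0),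
      ← Finset.sum_filter (fun r => r ≤ (s : ℕ))]
    have h2 : Finset.filter (fun r => r ≤ (s : ℕ)) (Finset.range N) = Finset.range (s + 1) := by
      ext r
      have := s.2
      simp only [Finset.mem_filter, Finset.mem_range]
      omega
    rw [h2]
    refine Finset.sum_congr rfl fun r _ => ?_
    simp only [eq_sub_iff_add_eq]
  simp only [h1, Finset.sum_const, Finset.card_univ, Fintype.card_fin, smul_eq_mul,
    Finset.mul_sum]
  rw [Finset.sum_comm]
  refine Finset.sum_congr rfl fun r _ => ?_
  split_ifs with h
  · simp
  · simp

theorem sum_range_sub_from (u : ℕ → ℤ) {r N : ℕ} (h : r ≤ N) :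
    (∑ s : Fin N, if r ≤ (s : ℕ) then u (s + 1) - u s else 0) = u N - u r := by
  rw [Fin.sum_univ_eq_sum_range (fun s => if r ≤ s then u (s + 1) - u s else 0)]
  induction N, h using Nat.le_induction with
  | base =>
    rw [sub_self]
    exact Finset.sum_eq_zero fun s hs => if_neg (by simpa using hs)
  | succ N hN ih =>
    rw [Finset.sum_range_succ, ih, if_pos hN]
    ring

/-- A graded subspace that is stable under a nilpotent endomorphism of degree one has a basis that
consists of strings. -/
theorem exists_string_generators [NeZero n] [∀ i, FiniteDimensional k (U i)]
    (hA : ∀ i, (U i).map A ≤ U (i + 1)) {N : ℕ} (hN : ∀ i, ∀ x ∈ U i, (A ^ N) x = 0) :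
    ∃ (c : ZMod n × Fin N → ℕ) (v : ArcType c → E),
      (∀ x, c x ≤ Module.finrank k (U x.1)) ∧
      (∀ g, v g ∈ U g.start ∧ (A ^ g.length) (v g) = 0) ∧
      (∀ i, U i ≤ Submodule.span k
        ((fun x : ArcPoint (ArcType.length (c := c)) => (A ^ (x.2 : ℕ)) (v x.1)) ''
          {x | arcVertex ArcType.start ArcType.length x = i})) ∧
      ∀ i, (Finset.univ.filter fun x : ArcPoint (ArcType.length (c := c)) =>
        arcVertex ArcType.start ArcType.length x = i).card = Module.finrank k (U i) := by
  -- The part of the layer `s + 1` accounted for by images of vectors at `i - 1` and by shorter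
  -- strings. A complement of it supplies the generators of the strings of length `s + 1` that start
  -- at `i`.
  set B : ZMod n → ℕ → Submodule k E := fun i s =>
    (socLayer A U (i - 1) (s + 2)).map A ⊔ socLayer A U i s with hB
  have hBle : ∀ i s, B i s ≤ socLayer A U i (s + 1) := by
    intro i s
    have := map_sup_socLayer_le hA (i - 1) s
    rwa [sub_add_cancel] at this
  have hBrank : ∀ i s, Module.finrank k (B i s) + Module.finrank k (socLayer A U (i - 1) (s + 1)) =
      Module.finrank k (socLayer A U (i - 1) (s + 2)) + Module.finrank k (socLayer A U i s) := by
    intro i s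
    have := finrank_map_sup_socLayer hA (i - 1) s
    rwa [sub_add_cancel] at this
  choose f hf hf' using fun i s => exists_generators_of_le (hBle i s)
  set c : ZMod n × Fin N → ℕ := fun x =>
    Module.finrank k (socLayer A U x.1 (x.2 + 1)) - Module.finrank k (B x.1 x.2) with hc
  set v : ArcType c → E := fun g => f g.1.1 g.1.2 g.2 with hv
  have hvmem : ∀ g, v g ∈ U g.start ∧ (A ^ g.length) (v g) = 0 :=
    fun g => hf g.1.1 g.1.2 g.2
  refine ⟨c, v, fun x => ?_, hvmem, ?_, fun i => ?_⟩
  · exact (Nat.sub_le _ _).trans (Submodule.finrank_mono inf_le_left)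
  · set S : ZMod n → Submodule k E := fun i => Submodule.span k
        ((fun x : ArcPoint (ArcType.length (c := c)) => (A ^ (x.2 : ℕ)) (v x.1)) ''
          {x | arcVertex ArcType.start ArcType.length x = i}) with hS
    have hSA : ∀ i, (S i).map A ≤ S (i + 1) := by
      intro i
      rw [hS, Submodule.map_span, Submodule.span_le]
      rintro _ ⟨_, ⟨x, hx, rfl⟩, rfl⟩
      simp only
      rw [← Module.End.mul_apply, ← pow_succ']
      by_cases hlt : (x.2 : ℕ) + 1 < x.1.length
      · refine Submodule.subset_span ⟨⟨x.1, ⟨x.2 + 1, hlt⟩⟩, ?_, rfl⟩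
        rw [Set.mem_ofPred_eq] at hx ⊢
        rw [← hx, arcVertex, arcVertex]
        push_cast
        ring
      · rw [pow_apply_eq_zero_of_le (not_lt.1 hlt) (hvmem x.1).2]
        exact Submodule.zero_mem _
    -- The strings span `U` modulo the image of `A`; iterating this `N` times, nilpotency removes
    -- the remainder.
    have h1 : ∀ s ≤ N, ∀ i, socLayer A U i s ≤ S i ⊔ (U (i - 1)).map A := by
      intro s
      induction s with
      | zero =>
        intro _ i x hx
        have : x = 0 := hx.2
        rw [this]
        exact Submodule.zero_mem _
      | succ s ih =>
        intro hs i
        refine (hf' i s).trans (sup_le (sup_le ?_ (ih (by omega) i)) ?_)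
        · exact (Submodule.map_mono inf_le_left).trans le_sup_right
        · refine le_trans ?_ le_sup_left
          rw [Submodule.span_le]
          rintro _ ⟨t, rfl⟩
          refine Submodule.subset_span ⟨⟨⟨(i, ⟨s, hs⟩), t⟩, ⟨0, Nat.succ_pos _⟩⟩, ?_, ?_⟩
          · simp [arcVertex]
          · simp [hv]
    have h2 : ∀ i, U i ≤ S i ⊔ (U (i - 1)).map A := fun i x hx =>
      h1 N le_rfl i ⟨hx, hN i x hx⟩
    have hSt : ∀ (t : ℕ) (i : ZMod n), ∀ x ∈ S i, (A ^ t) x ∈ S (i + t) := by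
      intro t
      induction t with
      | zero =>
        intro i x hx
        simpa using hx
      | succ t ih =>
        intro i x hx
        rw [pow_succ', Module.End.mul_apply, Nat.cast_succ, ← add_assoc]
        exact hSA _ ⟨_, ih i x hx, rfl⟩
    have h3 : ∀ t : ℕ, ∀ i, ∀ x ∈ U i, ∃ y ∈ S i, ∃ z ∈ U (i - t), x = y + (A ^ t) z := by
      intro t
      induction t with
      | zero =>
        intro i x hx
        exact ⟨0, Submodule.zero_mem _, x, by simpa using hx, by simp⟩
      | succ t ih =>
        intro i x hx
        obtain ⟨y, hy, z, hz, rfl⟩ := ih i x hx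
        obtain ⟨y', hy', _, ⟨z', hz', rfl⟩, rfl⟩ := Submodule.mem_sup.1 (h2 _ hz)
        refine ⟨y + (A ^ t) y', Submodule.add_mem _ hy ?_, z', ?_, ?_⟩
        · have := hSt t _ y' hy'
          rwa [sub_add_cancel] at this
        · rwa [Nat.cast_succ, ← sub_sub]
        · rw [map_add, pow_succ, Module.End.mul_apply, add_assoc]
    intro i x hx
    obtain ⟨y, hy, z, hz, rfl⟩ := h3 N i x hx
    rw [hN _ z hz, add_zero]
    exact hy
  · rw [card_arcType]
    set u : ZMod n → ℕ → ℤ := fun i s => Module.finrank k (socLayer A U i s) with hu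
    have hcZ : ∀ (i : ZMod n) (s : Fin N), (c (i, s) : ℤ) =
        (u i (s + 1) - u i s) - (u (i - 1) (s + 1 + 1) - u (i - 1) (s + 1)) := by
      intro i s
      have h1 := hBrank i s
      have h2 := Submodule.finrank_mono (hBle i s)
      simp only [hc, hu]
      rw [Nat.cast_sub h2]
      zify at h1
      linarith
    have huN : ∀ i s, N ≤ s → u i s = Module.finrank k (U i) := by
      intro i s hs
      have : socLayer A U i s = U i :=
        inf_eq_left.2 fun x hx => pow_apply_eq_zero_of_le hs (hN i x hx)
      simp only [hu]
      rw [this]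
    -- By `hcZ`, `c` is a second difference of layer dimensions, so the count telescopes twice: here
    -- over `s`, afterwards over `r`.
    have hinner : ∀ r ∈ Finset.range N,
        (∑ s : Fin N, if r ≤ (s : ℕ) then (c (i - r, s) : ℤ) else 0) =
        ((Module.finrank k (U (i - (r : ℕ))) : ℤ) - u (i - (r : ℕ)) r) -
          ((Module.finrank k (U (i - (r + 1 : ℕ))) : ℤ) - u (i - (r + 1 : ℕ)) (r + 1)) := by
      intro r hr
      have hr' : r ≤ N := (Finset.mem_range.1 hr).le
      have e1 := sum_range_sub_from (u (i - r)) hr'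
      have e2 := sum_range_sub_from (fun s => u (i - r - 1) (s + 1)) hr'
      have hi : i - ((r + 1 : ℕ) : ZMod n) = i - r - 1 := by
        push_cast
        ring
      rw [hi, ← huN (i - r) N le_rfl, ← huN (i - r - 1) (N + 1) (by omega), ← e1, ← e2,
        ← Finset.sum_sub_distrib]
      refine Finset.sum_congr rfl fun s _ => ?_
      split_ifs
      · exact hcZ _ _
      · simp
    apply Nat.cast_injective (R := ℤ)
    simp only [Nat.cast_sum, Nat.cast_ite, Nat.cast_zero]
    rw [Finset.sum_congr rfl hinner, Finset.sum_range_sub']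
    rw [huN _ N le_rfl]
    have h0 : u i 0 = 0 := by
      have : socLayer A U i 0 = ⊥ := by
        ext x
        simp only [mem_socLayer, pow_zero, Module.End.one_apply, Submodule.mem_bot]
        exact ⟨fun h => h.2, fun h => ⟨h ▸ Submodule.zero_mem _, h⟩⟩
      simp only [hu]
      rw [this, finrank_bot, Nat.cast_zero]
    have hi : i - ((0 : ℕ) : ZMod n) = i := by simp
    rw [hi, h0, sub_self, sub_zero, sub_zero]

end Generators

/-! ### Parametrized strata -/

section Shift

variable (k : Type*) [Field k] (β : Type*)

/-- The shift on families of sequences. -/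
def shift : (β → ℕ → k) →ₗ[k] (β → ℕ → k) where
  toFun f b r := f b (r + 1)
  map_add' _ _ := rfl
  map_smul' _ _ := rfl

variable {k β}

@[simp]
theorem shift_apply (f : β → ℕ → k) (b : β) (r : ℕ) : shift k β f b r = f b (r + 1) := rfl

@[simp]
theorem shift_pow_apply (s : ℕ) (f : β → ℕ → k) (b : β) (r : ℕ) :
    (shift k β ^ s) f b r = f b (r + s) := by
  induction s generalizing f with
  | zero => rfl
  | succ s ih =>
    rw [pow_succ, Module.End.mul_apply, ih, shift_apply, add_assoc]

end Shift

section Strings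

variable {k : Type*} [Field k] {n : ℕ} {β Γ : Type*} (j : β → ZMod n) (q : Γ → ZMod n)
  (len : Γ → ℕ)

/-- The vectors that generate a string of the given shape. -/
def IsStringFamily (w : Γ → β → ℕ → k) : Prop :=
  ∀ g b r, w g b r ≠ 0 → r < len g ∧ q g + r = j b

/-- The linear independence of the strings generated by a family of vectors. -/
def StringIndependent [Fintype Γ] (w : Γ → β → ℕ → k) : Prop :=
  ∀ (i : ZMod n) (C : ArcPoint len → k), (∀ x, arcVertex q len x ≠ i → C x = 0) →
    ∑ x, C x • (shift k β ^ (x.2 : ℕ)) (w x.1) = 0 → C = 0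

/-- The coordinates of families of vectors that generate strings. -/
abbrev StringCoord : Type _ := {x : ArcPoint len × β // arcVertex q len x.1 = j x.2}

variable {j q len}

/-- The family of vectors with given coordinates. -/
def stringFamily : (StringCoord j q len → k) →ₗ[k] (Γ → β → ℕ → k) where
  toFun v g b r := if h : ∃ hr : r < len g, arcVertex q len ⟨g, ⟨r, hr⟩⟩ = j b then
    v ⟨(⟨g, ⟨r, h.1⟩⟩, b), h.2⟩ else 0
  map_add' v v' := by
    ext g b r
    simp only [Pi.add_apply]
    split_ifs <;> simp
  map_smul' c v := by
    ext g b r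
    simp only [Pi.smul_apply, RingHom.id_apply]
    split_ifs <;> simp

theorem isStringFamily_stringFamily (v : StringCoord j q len → k) :
    IsStringFamily j q len (stringFamily v) := by
  intro g b r h
  simp only [stringFamily, LinearMap.coe_mk, AddHom.coe_mk] at h
  split_ifs at h with h'
  · exact ⟨h'.1, h'.2⟩
  · exact absurd rfl h

theorem IsStringFamily.exists_coord {w : Γ → β → ℕ → k} (h : IsStringFamily j q len w) :
    ∃ v : StringCoord j q len → k, stringFamily v = w := by
  refine ⟨fun x => w x.1.1.1 x.1.2 x.1.1.2, ?_⟩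
  ext g b r
  simp only [stringFamily, LinearMap.coe_mk, AddHom.coe_mk]
  split_ifs with h'
  · rfl
  · by_contra hne
    obtain ⟨h1, h2⟩ := h g b r (Ne.symm hne)
    exact h' ⟨h1, h2⟩

theorem IsStringFamily.pow_eq_zero {w : Γ → β → ℕ → k} (h : IsStringFamily j q len w) {g : Γ}
    {s : ℕ} (hs : len g ≤ s) : (shift k β ^ s) (w g) = 0 := by
  ext b r
  rw [shift_pow_apply]
  by_contra hne
  have := (h g b _ hne).1
  omega

variable (q len) in
/-- The coordinates of the endomorphism ring of the representation that is made of strings. -/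
abbrev EndCoord : Type _ :=
  {x : Γ × ArcPoint len // arcVertex q len x.2 = q x.1 ∧ arcHeight x.2 ≤ len x.1}

open Classical in
/-- The coefficient of an endomorphism. -/
noncomputable def endCoeff : (EndCoord q len → k) →ₗ[k] (Γ → ArcPoint len → k) where
  toFun a g x := if h : arcVertex q len x = q g ∧ arcHeight x ≤ len g then a ⟨(g, x), h⟩ else 0
  map_add' v v' := by
    ext g x
    simp only [Pi.add_apply]
    split_ifs <;> simp
  map_smul' c v := by
    ext g x
    simp only [Pi.smul_apply, RingHom.id_apply]
    split_ifs <;> simp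

theorem endCoeff_ne_zero {a : EndCoord q len → k} {g : Γ} {x : ArcPoint len}
    (h : endCoeff a g x ≠ 0) : arcVertex q len x = q g ∧ arcHeight x ≤ len g := by
  simp only [endCoeff, LinearMap.coe_mk, AddHom.coe_mk] at h
  split_ifs at h with h'
  · exact h'
  · exact absurd rfl h

theorem isPolyFun_endCoeff (g : Γ) (x : ArcPoint len) :
    IsPolyFun fun a : EndCoord q len → k => endCoeff a g x := by
  simp only [endCoeff, LinearMap.coe_mk, AddHom.coe_mk]
  split_ifs
  · exact IsPolyFun.coord _
  · exact IsPolyFun.const _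

/-! ### The action of endomorphisms on generators of strings -/

section Action

variable [Fintype Γ]

/-- The action of an endomorphism on generators of strings. -/
noncomputable def endActFamily (w : Γ → β → ℕ → k) (a : EndCoord q len → k) : Γ → β → ℕ → k :=
  fun g => ∑ x, endCoeff a g x • (shift k β ^ (x.2 : ℕ)) (w x.1)

theorem endActFamily_apply (w : Γ → β → ℕ → k) (a : EndCoord q len → k) (g : Γ) (b : β) (r : ℕ) :
    endActFamily w a g b r = ∑ x : ArcPoint len, endCoeff a g x * w x.1 b (r + x.2) := by
  simp [endActFamily, Finset.sum_apply]

/-- The height condition on the coefficients preserves the relation that the `len g`-th shift kills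
generator `g`; the vertex condition preserves its degree. -/
theorem isStringFamily_endActFamily {w : Γ → β → ℕ → k} (hw : IsStringFamily j q len w)
    (a : EndCoord q len → k) : IsStringFamily j q len (endActFamily w a) := by
  intro g b r h
  rw [endActFamily_apply] at h
  obtain ⟨x, -, hx⟩ := Finset.exists_ne_zero_of_sum_ne_zero h
  obtain ⟨h1, h2⟩ := endCoeff_ne_zero (left_ne_zero_of_mul hx)
  obtain ⟨h3, h4⟩ := hw _ _ _ (right_ne_zero_of_mul hx)
  unfold arcHeight at h2
  unfold arcVertex at h1
  refine ⟨by omega, ?_⟩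
  rw [← h4, ← h1]
  push_cast
  ring

/-- The action of endomorphisms on the coordinates of generators of strings. -/
noncomputable def endAct (v : StringCoord j q len → k) :
    (EndCoord q len → k) →ₗ[k] (StringCoord j q len → k) where
  toFun a y := endActFamily (stringFamily v) a y.1.1.1 y.1.2 y.1.1.2
  map_add' a a' := by
    ext y
    simp [endActFamily_apply, add_mul, Finset.sum_add_distrib]
  map_smul' c a := by
    ext y
    simp [endActFamily_apply, mul_assoc, Finset.mul_sum]

theorem stringFamily_endAct (v : StringCoord j q len → k) (a : EndCoord q len → k) :
    stringFamily (endAct v a) = endActFamily (stringFamily v) a := by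
  ext g b r
  change (if h : ∃ hr : r < len g, arcVertex q len ⟨g, ⟨r, hr⟩⟩ = j b then
    endActFamily (stringFamily v) a g b r else 0) = _
  split_ifs with h'
  · rfl
  · by_contra hne
    obtain ⟨h1, h2⟩ :=
      isStringFamily_endActFamily (isStringFamily_stringFamily v) a g b r (Ne.symm hne)
    exact h' ⟨h1, h2⟩

theorem isPolyFun_endAct [Finite β] (a : EndCoord q len → k) (y : StringCoord j q len) :
    IsPolyFun fun v => endAct v a y := by
  have : ∀ v, endAct v a y =
      ∑ x : ArcPoint len, endCoeff a y.1.1.1 x * stringFamily v x.1 y.1.2 (y.1.1.2 + x.2) :=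
    fun v => endActFamily_apply _ _ _ _ _
  rw [funext this]
  refine IsPolyFun.sum fun x _ => (IsPolyFun.const _).mul ?_
  exact IsPolyFun.linear (LinearMap.proj (R := k) (φ := fun _ : ℕ => k) ((y.1.1.2 : ℕ) + (x.2 : ℕ)) ∘ₗ LinearMap.proj y.1.2 ∘ₗ
    LinearMap.proj x.1 ∘ₗ stringFamily)

/-- If all generators are sent to zero, the coefficients form linear relations among the independent
strings. So the orbit directions at an embedding have the full dimension of the endomorphism ring.
-/
theorem injective_endAct {v : StringCoord j q len → k}
    (hv : StringIndependent q len (stringFamily v)) : Function.Injective (endAct v) := by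
  rw [← LinearMap.ker_eq_bot, LinearMap.ker_eq_bot']
  intro a ha
  have h1 := stringFamily_endAct v a
  rw [ha, map_zero] at h1
  have h2 : ∀ g, endCoeff a g = 0 := by
    intro g
    refine hv (q g) _ (fun x hx => ?_) (congrFun h1 g).symm
    by_contra hne
    exact hx (endCoeff_ne_zero hne).1
  ext ⟨⟨g, x⟩, hx⟩
  have := congrFun (h2 g) x
  simpa [endCoeff, hx] using this

end Action

/-- The matrix of an endomorphism on the points over a vertex. -/
noncomputable def endMatrix (a : EndCoord q len → k) (i : ZMod n) :
    Matrix {x : ArcPoint len // arcVertex q len x = i} {x : ArcPoint len // arcVertex q len x = i}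
      k :=
  Matrix.of fun x' x => if (x.1.2 : ℕ) ≤ x'.1.2 then
    endCoeff a x.1.1 ⟨x'.1.1, ⟨x'.1.2 - x.1.2, lt_of_le_of_lt (Nat.sub_le _ _) x'.1.2.2⟩⟩ else 0

theorem isPolyFun_endMatrix (i : ZMod n)
    (x' x : {x : ArcPoint len // arcVertex q len x = i}) :
    IsPolyFun fun a : EndCoord q len → k => endMatrix a i x' x := by
  simp only [endMatrix, Matrix.of_apply]
  split_ifs
  · exact isPolyFun_endCoeff _ _
  · exact IsPolyFun.const _

section Identity

variable [DecidableEq Γ]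

/-- The coordinates of the identity. -/
def idEnd : EndCoord q len → k :=
  fun y => if y.1.2.1 = y.1.1 ∧ (y.1.2.2 : ℕ) = 0 then 1 else 0

theorem endMatrix_idEnd (i : ZMod n) : endMatrix (idEnd (k := k) (q := q) (len := len)) i = 1 := by
  ext ⟨⟨g', r'⟩, h'⟩ ⟨⟨g, r⟩, h⟩
  rw [Matrix.one_apply]
  simp only [endMatrix, Matrix.of_apply, endCoeff, LinearMap.coe_mk, AddHom.coe_mk, idEnd]
  by_cases hg : g' = g
  · subst hg
    by_cases hr : (r : ℕ) = r'
    · have hr' := Fin.ext hr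
      subst hr'
      simp [arcVertex, arcHeight]
    · rw [if_neg (c := (⟨⟨g', r'⟩, h'⟩ : {x : ArcPoint len // arcVertex q len x = i}) = _)]
      · split_ifs
        · omega
        · rfl
        · rfl
        · rfl
      · rintro h3
        apply hr
        simp only [Subtype.mk.injEq, Sigma.mk.injEq, heq_eq_eq, true_and] at h3
        rw [h3]
  · rw [if_neg (c := (⟨⟨g', r'⟩, h'⟩ : {x : ArcPoint len // arcVertex q len x = i}) = _)]
    · simp [hg]
    · rintro h3
      simp only [Subtype.mk.injEq, Sigma.mk.injEq] at h3
      exact hg h3.1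

end Identity

theorem sum_fin_add_eq {M : Type*} [AddCommMonoid M] {N s : ℕ} (G : ℕ → M)
    (hG : ∀ r, N ≤ r + s → G r = 0) :
    ∑ r : Fin N, G r = ∑ r : Fin N, if s ≤ (r : ℕ) then G (r - s) else 0 := by
  rw [Fin.sum_univ_eq_sum_range G, Fin.sum_univ_eq_sum_range fun r => if s ≤ r then G (r - s) else 0,
    ← Finset.sum_filter]
  refine Finset.sum_bij_ne_zero (fun r _ _ => r + s) ?_ ?_ ?_ ?_
  · intro r hr h
    have : ¬ N ≤ r + s := fun h' => h (hG r h')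
    simp only [Finset.mem_filter, Finset.mem_range]
    omega
  · intro r _ _ r' _ _ h
    omega
  · intro r hr h
    simp only [Finset.mem_filter, Finset.mem_range] at hr
    exact ⟨r - s, Finset.mem_range.2 (by omega), h, by omega⟩
  · intro r _ _
    rw [Nat.add_sub_cancel]

variable [Fintype Γ]

/-- An endomorphism commutes with the shift, so on the vectors over one vertex it acts by
`endMatrix`. Terms moved past the end of a string vanish, which permits the reindexing. -/
theorem shift_pow_endActFamily {w : Γ → β → ℕ → k} (hw : IsStringFamily j q len w)
    (a : EndCoord q len → k) (i : ZMod n) (x : {x : ArcPoint len // arcVertex q len x = i}) :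
    (shift k β ^ (x.1.2 : ℕ)) (endActFamily w a x.1.1) =
      ∑ x', endMatrix a i x' x • (shift k β ^ (x'.1.2 : ℕ)) (w x'.1.1) := by
  classical
  obtain ⟨⟨g, s⟩, hx⟩ := x
  have h1 : ∀ h : Γ, ∑ r : Fin (len h), endCoeff a g ⟨h, r⟩ • (shift k β ^ ((r : ℕ) + s)) (w h) =
      ∑ r : Fin (len h), (if (s : ℕ) ≤ r then
        endCoeff a g ⟨h, ⟨r - s, lt_of_le_of_lt (Nat.sub_le _ _) r.2⟩⟩ else 0) •
          (shift k β ^ (r : ℕ)) (w h) := by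
    intro h
    have h2 := sum_fin_add_eq (N := len h) (s := s) (fun r => (if hr : r < len h then
      endCoeff a g ⟨h, ⟨r, hr⟩⟩ else 0) • (shift k β ^ (r + s)) (w h)) fun r hr => by
        rw [hw.pow_eq_zero hr, smul_zero]
    convert h2 using 2 with r _ r _
    · rw [dif_pos r.2]
    · split_ifs with h3 h4
      · rw [Nat.sub_add_cancel h3]
      · exact absurd (lt_of_le_of_lt (Nat.sub_le _ _) r.2) h4
      · rw [zero_smul]
  have h2 : (shift k β ^ (s : ℕ)) (endActFamily w a g) =
      ∑ x : ArcPoint len, endCoeff a g x • (shift k β ^ ((x.2 : ℕ) + s)) (w x.1) := by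
    rw [endActFamily, map_sum]
    refine Finset.sum_congr rfl fun x _ => ?_
    rw [map_smul, add_comm, pow_add, Module.End.mul_apply]
  simp only
  rw [h2, Fintype.sum_sigma, Finset.sum_congr rfl fun h _ => h1 h, ← Fintype.sum_sigma']
  set G : ArcPoint len → β → ℕ → k := fun x => (if (s : ℕ) ≤ x.2 then
    endCoeff a g ⟨x.1, ⟨x.2 - s, lt_of_le_of_lt (Nat.sub_le _ _) x.2.2⟩⟩ else 0) •
      (shift k β ^ (x.2 : ℕ)) (w x.1) with hG
  change ∑ x, G x = ∑ x' : {x : ArcPoint len // arcVertex q len x = i}, G x'.1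
  rw [← Finset.sum_subtype (Finset.univ.filter fun x => arcVertex q len x = i) (by simp) G]
  symm
  refine Finset.sum_subset (Finset.filter_subset _ _) fun x _ hx' => ?_
  simp only [hG]
  split_ifs with h3
  · by_cases h4 : endCoeff a g ⟨x.1, ⟨x.2 - s, lt_of_le_of_lt (Nat.sub_le _ _) x.2.2⟩⟩ = 0
    · rw [h4, zero_smul]
    · refine absurd ?_ hx'
      rw [Finset.mem_filter]
      refine ⟨Finset.mem_univ _, ?_⟩
      have h5 := (endCoeff_ne_zero h4).1
      simp only [arcVertex] at h5 hx ⊢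
      rw [← hx, ← h5, Nat.cast_sub h3]
      ring
  · rw [zero_smul]

variable [DecidableEq Γ]

/-- Precomposing an embedding with an automorphism does not change its image: the inverse matrix
corrects the coefficients so that the very same vectors result. -/
theorem exists_inv_endMatrix [Fintype β] {I : Type*} {c : I → ZMod n} {e : I → ℕ}
    (v : StringCoord j q len → k) (a : EndCoord q len → k)
    (ha : ∀ i, (endMatrix a i).det ≠ 0)
    (g : (Σ i, {x : ArcPoint len // arcVertex q len x = c i} × Fin (e i)) → k) :
    ∃ g' : (Σ i, {x : ArcPoint len // arcVertex q len x = c i} × Fin (e i)) → k, ∀ i t,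
      ∑ x, g' ⟨i, x, t⟩ • (shift k β ^ (x.1.2 : ℕ)) (stringFamily (endAct v a) x.1.1) =
        ∑ x, g ⟨i, x, t⟩ • (shift k β ^ (x.1.2 : ℕ)) (stringFamily v x.1.1) := by
  refine ⟨fun y => ((endMatrix a (c y.1))⁻¹.mulVec fun x => g ⟨y.1, x, y.2.2⟩) y.2.1,
    fun i t => ?_⟩
  have h1 : (endMatrix a (c i)).mulVec ((endMatrix a (c i))⁻¹.mulVec fun x => g ⟨i, x, t⟩) =
      fun x => g ⟨i, x, t⟩ := by
    rw [Matrix.mulVec_mulVec, Matrix.mul_nonsing_inv _ (isUnit_iff_ne_zero.2 (ha (c i))),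
      Matrix.one_mulVec]
  simp only [stringFamily_endAct,
    shift_pow_endActFamily (isStringFamily_stringFamily v) a (c i), Finset.smul_sum, smul_smul]
  rw [Finset.sum_comm]
  refine Finset.sum_congr rfl fun x' _ => ?_
  rw [← Finset.sum_smul]
  congr 1
  rw [← congrFun h1 x', Matrix.mulVec, dotProduct]
  exact Finset.sum_congr rfl fun x _ => mul_comm _ _

end Strings

/-! ### Representations of the cycle with shifts as maps -/

section Standard

universe w u

namespace CyclicQuiver

variable {n : ℕ}

instance decidableEq (n : ℕ) : DecidableEq (CyclicQuiver n) :=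
  inferInstanceAs (DecidableEq (ZMod n))

/-- The residue class of a vertex of the cycle. -/
def idx (i : CyclicQuiver n) : ZMod n := i

/-- The vertex of the cycle with a given residue class. -/
def vertex (i : ZMod n) : CyclicQuiver n := i

@[simp]
theorem idx_vertex (i : ZMod n) : (vertex i).idx = i := rfl

/-- The arrow of the cycle that starts at a given vertex. -/
def arrow (i : CyclicQuiver n) : i ⟶ vertex (i.idx + 1) := ⟨rfl⟩

end CyclicQuiver

/-- Coordinates of a representation of the cycle that is the direct sum of strings of length `N`,
where the string `b` ends at the vertex `j b`. The coordinate `(b, r)` lives at the vertex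
`j b - r`. -/
structure StandardRep {k : Type u} [Field k] {n : ℕ} (R : QuiverRep.{w} k (CyclicQuiver n))
    (N : ℕ) {β : Type} (j : β → ZMod n) where
  /-- the coordinates -/
  emb : ∀ q : CyclicQuiver n, R.V q →ₗ[k] (β → ℕ → k)
  injective : ∀ q, Function.Injective (emb q)
  mem_range : ∀ (q : CyclicQuiver n) (f : β → ℕ → k), f ∈ LinearMap.range (emb q) ↔
    ∀ b r, f b r ≠ 0 → r < N ∧ q.idx + r = j b
  map : ∀ (q : CyclicQuiver n) (x : R.V q),
    emb (CyclicQuiver.vertex (q.idx + 1)) (R.map (CyclicQuiver.arrow q) x) = shift k β (emb q x)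

variable {k : Type u} [Field k] {n : ℕ} {R : QuiverRep.{w} k (CyclicQuiver n)} {N : ℕ} {β : Type}
  {j : β → ZMod n}

theorem StandardRep.pow_eq_zero (hR : StandardRep R N j) {q : CyclicQuiver n} (x : R.V q) :
    (shift k β ^ N) (hR.emb q x) = 0 := by
  ext b r
  rw [shift_pow_apply]
  by_contra h
  have := ((hR.mem_range q _).1 ⟨x, rfl⟩ b _ h).1
  omega

theorem evalFrame_aeval {I : Type*} {V : I → Type*} [∀ i, AddCommGroup (V i)]
    [∀ i, Module k (V i)] {e : I → ℕ} {ν : Type*} (F : ∀ i, Fin (e i) → V i)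
    (y : ν → MvPolynomial (Module.Dual k (∀ i, Fin (e i) → V i)) k) (P : MvPolynomial ν k) :
    evalFrame F (MvPolynomial.aeval y P) = MvPolynomial.eval (fun j => evalFrame F (y j)) P := by
  rw [MvPolynomial.aeval_eq_bind₁, evalFrame]
  have h := MvPolynomial.aeval_bind₁ (S := k) (fun φ => φ F) y P
  simp only [MvPolynomial.aeval_eq_eval] at h
  exact h

section StringFrame

variable {Γ : Type} [Fintype Γ] {q : Γ → ZMod n} {len : Γ → ℕ} {e : CyclicQuiver n → ℕ}

variable (q len e) in
/-- Coordinates of families of vectors in the span of strings. -/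
abbrev StringCoeff : Type :=
  Σ i : CyclicQuiver n, {x : ArcPoint len // arcVertex q len x = i.idx} × Fin (e i)

/-- Families of vectors in the span of strings. -/
def stringFrame (D : ∀ i, (β → ℕ → k) →ₗ[k] R.V i) (v : StringCoord j q len → k)
    (g : StringCoeff q len e → k) : ∀ i, Fin (e i) → R.V i :=
  fun i t => D i (∑ x, g ⟨i, x, t⟩ • (shift k β ^ (x.1.2 : ℕ)) (stringFamily v x.1.1))

theorem apply_stringFrame [NeZero n] (D : ∀ i, (β → ℕ → k) →ₗ[k] R.V i)
    (φ : Module.Dual k (∀ i, Fin (e i) → R.V i)) (v : StringCoord j q len → k)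
    (g : StringCoeff q len e → k) :
    φ (stringFrame D v g) = ∑ i : CyclicQuiver n, ∑ t : Fin (e i),
      ∑ z : {x : ArcPoint len // arcVertex q len x = i.idx}, g ⟨i, z, t⟩ *
        φ (Pi.single i (Pi.single t
          (D i ((shift k β ^ (z.1.2 : ℕ)) (stringFamily v z.1.1))))) := by
  have h1 : stringFrame D v g = ∑ i : CyclicQuiver n,
      LinearMap.single k (fun i => Fin (e i) → R.V i) i (∑ t : Fin (e i),
        LinearMap.single k (fun _ => R.V i) t (stringFrame D v g i t)) := by
    simp only [LinearMap.coe_single, Finset.univ_sum_single]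
  rw [h1]
  simp only [map_sum]
  refine Finset.sum_congr rfl fun i _ => Finset.sum_congr rfl fun t _ => ?_
  simp only [stringFrame, map_sum, map_smul, smul_eq_mul]
  rfl

/-- The vectors of the frame are bilinear in the coordinates of the generators and the coefficients.
-/
theorem isPolyFun_stringFrame [NeZero n] [Finite β] (D : ∀ i, (β → ℕ → k) →ₗ[k] R.V i)
    (p : MvPolynomial (Module.Dual k (∀ i, Fin (e i) → R.V i)) k) :
    IsPolyFun fun x : StringCoord j q len ⊕ StringCoeff q len e → k =>
      evalFrame (stringFrame D (x ∘ Sum.inl) (x ∘ Sum.inr)) p := by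
  refine IsPolyFun.eval (w := fun x (φ : Module.Dual k (∀ i, Fin (e i) → R.V i)) =>
    φ (stringFrame D (x ∘ Sum.inl) (x ∘ Sum.inr))) (fun φ => ?_) p
  simp only [apply_stringFrame]
  refine IsPolyFun.sum fun i _ => IsPolyFun.sum fun t _ => IsPolyFun.sum fun z _ =>
    (IsPolyFun.coord _).mul ?_
  let L : (StringCoord j q len → k) →ₗ[k] k :=
    φ ∘ₗ LinearMap.single k (fun i => Fin (e i) → R.V i) i ∘ₗ
      LinearMap.single k (fun _ => R.V i) t ∘ₗ D i ∘ₗ (shift k β ^ (z.1.2 : ℕ)) ∘ₗ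
        LinearMap.proj z.1.1 ∘ₗ stringFamily
  have hL : IsPolyFun fun x : StringCoord j q len ⊕ StringCoeff q len e → k =>
      L (x ∘ Sum.inl) := (IsPolyFun.linear L).comp fun s => IsPolyFun.coord _
  exact hL

end StringFrame

/-- More functions than the expected dimension are algebraically dependent on the frames of
subrepresentations of a given isomorphism class. -/
theorem exists_relation_of_arcs [NeZero n] [Infinite k] [Fintype β] (hR : StandardRep R N j)
    {e : CyclicQuiver n → ℕ} {K : ℕ} (he : ∀ i, e i = K) {Γ : Type} [Fintype Γ]
    {q : Γ → ZMod n} {len : Γ → ℕ}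
    (hK : ∀ i, (Finset.univ.filter fun x : ArcPoint len => arcVertex q len x = i).card = K)
    {ν : Type*} [Fintype ν] (y : ν → MvPolynomial (Module.Dual k (∀ i, Fin (e i) → R.V i)) k)
    (hcard : Fintype.card β * K + Fintype.card (BaseChange e) <
      Fintype.card ν + ∑ g, arcCount q len (q g) (len g)) :
    ∃ Q : MvPolynomial ν k, Q ≠ 0 ∧ ∀ (F : ∀ i, Fin (e i) → R.V i) (w : Γ → β → ℕ → k),
      IsStringFamily j q len w → StringIndependent q len w →
      (∀ i t, hR.emb i (F i t) ∈ Submodule.span k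
        ((fun x : ArcPoint len => (shift k β ^ (x.2 : ℕ)) (w x.1)) ''
          {x | arcVertex q len x = i.idx})) →
      evalFrame F (MvPolynomial.aeval y Q) = 0 := by
  classical
  -- An empty stratum needs no relation; otherwise an independent family serves as the base point
  -- `v₀` with injective action.
  by_cases hex : ∃ w : Γ → β → ℕ → k, IsStringFamily j q len w ∧ StringIndependent q len w
  swap
  · exact ⟨1, one_ne_zero, fun F w h1 h2 => absurd ⟨w, h1, h2⟩ hex⟩
  obtain ⟨w₀, hw₀, hw₀'⟩ := hex
  obtain ⟨v₀, rfl⟩ := hw₀.exists_coord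
  choose D hD using fun i => LinearMap.exists_leftInverse_of_injective (hR.emb i)
    (LinearMap.ker_eq_bot.2 (hR.injective i))
  have hD' : ∀ i (x : R.V i), D i (hR.emb i x) = x := fun i x => LinearMap.congr_fun (hD i) x
  -- This is `dim Hom(U, M)`: each string `b` of `M` contributes the `K` points of `U` over its end
  -- vertex.
  have hcardσ : Fintype.card (StringCoord j q len) = Fintype.card β * K := by
    rw [Fintype.card_subtype, Finset.card_filter, Fintype.sum_prod_type_right]
    simp only [← Finset.card_filter, hK, Finset.sum_const, Finset.card_univ, smul_eq_mul]
  have hcardx : ∀ i, Fintype.card {x : ArcPoint len // arcVertex q len x = i} = K := fun i => by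
    rw [Fintype.card_subtype, hK]
  have hcardγ : Fintype.card (StringCoeff q len e) = Fintype.card (BaseChange e) := by
    rw [Fintype.card_sigma, Fintype.card_sigma]
    refine Finset.sum_congr rfl fun i _ => ?_
    rw [Fintype.card_prod, Fintype.card_prod, hcardx, Fintype.card_fin, he i]
  have hcardε : Fintype.card (EndCoord q len) = ∑ g, arcCount q len (q g) (len g) := by
    rw [Fintype.card_subtype, Finset.card_filter, Fintype.sum_prod_type]
    simp only [← Finset.card_filter]
    rfl
  have hinv : ∀ (v : StringCoord j q len → k) (a : EndCoord q len → k)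
      (g : StringCoeff q len e → k), (∏ i : ZMod n, (endMatrix a i).det) ≠ 0 →
      ∃ g', ∀ l, evalFrame (stringFrame D (endAct v a) g') (y l) =
        evalFrame (stringFrame D v g) (y l) := by
    intro v a g ha
    obtain ⟨g', hg'⟩ := exists_inv_endMatrix (c := CyclicQuiver.idx) v a
      (fun i => Finset.prod_ne_zero_iff.1 ha i (Finset.mem_univ _)) g
    refine ⟨g', fun l => ?_⟩
    have : stringFrame D (endAct v a) g' = stringFrame D v g := by
      ext i t
      exact congrArg (D i) (hg' i t)
    rw [this]
  obtain ⟨Q, hQ, hQ0⟩ := exists_relation_of_action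
    (fun l v g => evalFrame (stringFrame D v g) (y l))
    (fun l => isPolyFun_stringFrame D (y l)) endAct isPolyFun_endAct
    (fun a => ∏ i : ZMod n, (endMatrix a i).det)
    (IsPolyFun.prod fun i _ => IsPolyFun.det fun x' x => isPolyFun_endMatrix i x' x)
    (a₁ := idEnd) (by simp [endMatrix_idEnd]) hinv (injective_endAct hw₀')
    (by rw [hcardσ, hcardγ, hcardε]; exact hcard)
  refine ⟨Q, hQ, fun F w hw _ hF => ?_⟩
  obtain ⟨v, rfl⟩ := hw.exists_coord
  have h1 : ∀ i t, ∃ g : {x : ArcPoint len // arcVertex q len x = i.idx} → k,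
      ∑ x, g x • (shift k β ^ (x.1.2 : ℕ)) (stringFamily v x.1.1) = hR.emb i (F i t) := by
    intro i t
    have := hF i t
    rw [Set.image_eq_range] at this
    exact (Submodule.mem_span_range_iff_exists_fun k).1 this
  choose g hg using h1
  have h2 : stringFrame D v (fun y => g y.1 y.2.2 y.2.1) = F := by
    ext i t
    exact (congrArg (D i) (hg i t)).trans (hD' i _)
  rw [evalFrame_aeval, ← h2]
  exact hQ0 _ _

end Standard

/-! ### The upper bound -/

section UpperBound

universe w u

variable {k : Type u} [Field k] {n : ℕ} {β : Type} {j : β → ZMod n}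

theorem card_filter_natCast_eq [NeZero n] (ω : ℕ) (c : ZMod n) :
    (Finset.univ.filter fun r : Fin (ω * n) => ((r : ℕ) : ZMod n) = c).card = ω := by
  have h1 : (Finset.univ.filter fun s : Fin n => ((s : ℕ) : ZMod n) = c).card = 1 := by
    rw [Finset.card_eq_one]
    refine ⟨⟨c.val, ZMod.val_lt c⟩, ?_⟩
    ext s
    simp only [Finset.mem_filter, Finset.mem_univ, true_and, Finset.mem_singleton]
    constructor
    · rintro rfl
      exact Fin.ext (by simp [ZMod.val_natCast, Nat.mod_eq_of_lt s.2])
    · rintro rfl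
      simp
  rw [Finset.card_filter, ← Equiv.sum_comp finProdFinEquiv, Fintype.sum_prod_type]
  simp only [finProdFinEquiv_apply_val, Nat.cast_add, Nat.cast_mul, CharP.cast_eq_zero, zero_mul,
    add_zero, ← Finset.card_filter, h1]
  simp

theorem mul_card_le_of_string_count [NeZero n] {ω κ : ℕ} (hω : 1 ≤ ω) {Γ : Type} [Fintype Γ]
    {q : Γ → ZMod n} {len : Γ → ℕ} (hlen : ∀ g, len g ≤ ω * n)
    (hK : ∀ i, (Finset.univ.filter fun x : ArcPoint len => arcVertex q len x = i).card = ω * κ) :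
    ω * κ ^ 2 ≤ ∑ g, arcCount q len (q g) (len g) := by
  have hn : 0 < n := Nat.pos_of_neZero n
  have h := sum_arcCount_ge (N := ω * n) (by simp) (by positivity) hlen hK
  have h2 : ω * n * (ω * κ ^ 2) ≤ ω * n * ∑ g, arcCount q len (q g) (len g) := by
    calc ω * n * (ω * κ ^ 2) = n * (ω * κ) ^ 2 := by ring
      _ ≤ _ := h
  exact Nat.le_of_mul_le_mul_left h2 (by positivity)

variable {R : QuiverRep.{w} k (CyclicQuiver n)} {N : ℕ}

theorem StandardRep.map_shift_le (hR : StandardRep R N j) {U : ∀ i, Submodule k (R.V i)}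
    (hU : R.IsSubrep U) (i : ZMod n) :
    ((U (CyclicQuiver.vertex i)).map (hR.emb (CyclicQuiver.vertex i))).map (shift k β) ≤
      (U (CyclicQuiver.vertex (i + 1))).map (hR.emb (CyclicQuiver.vertex (i + 1))) := by
  rintro _ ⟨_, ⟨x, hx, rfl⟩, rfl⟩
  exact ⟨_, hU (CyclicQuiver.arrow (CyclicQuiver.vertex i)) ⟨x, hx, rfl⟩, hR.map _ x⟩

/-- At each vertex the shifted generators span a space of dimension at least their number, so they
are independent. -/
theorem stringIndependent_of_card {Γ : Type} [Fintype Γ] {q : Γ → ZMod n} {len : Γ → ℕ}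
    {w : Γ → β → ℕ → k} {W : ZMod n → Submodule k (β → ℕ → k)}
    (hW : ∀ i, W i ≤ Submodule.span k
      ((fun x : ArcPoint len => (shift k β ^ (x.2 : ℕ)) (w x.1)) '' {x | arcVertex q len x = i}))
    (hcard : ∀ i, (Finset.univ.filter fun x : ArcPoint len => arcVertex q len x = i).card =
      Module.finrank k (W i)) : StringIndependent q len w := by
  intro i C hC hsum
  have h1 : LinearIndependent k fun x : {x : ArcPoint len // arcVertex q len x = i} =>
      (shift k β ^ (x.1.2 : ℕ)) (w x.1.1) := by
    rw [linearIndependent_iff_card_eq_finrank_span]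
    refine le_antisymm ?_ (finrank_range_le_card _)
    rw [Fintype.card_subtype, hcard, Set.finrank]
    have h2 := hW i
    rw [Set.image_eq_range] at h2
    have := FiniteDimensional.span_of_finite k (Set.finite_range
      fun x : {x : ArcPoint len // arcVertex q len x = i} => (shift k β ^ (x.1.2 : ℕ)) (w x.1.1))
    exact Submodule.finrank_mono h2
  rw [Fintype.linearIndependent_iff] at h1
  have h3 := h1 (fun x => C x.1) (by
    rw [← Finset.sum_subtype (Finset.univ.filter fun x => arcVertex q len x = i) (by simp)
      fun x => C x • (shift k β ^ (x.2 : ℕ)) (w x.1), ← hsum]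
    refine Finset.sum_subset (Finset.filter_subset _ _) fun x _ hx => ?_
    rw [hC x (by simpa using hx), zero_smul])
  funext x
  by_cases hx : arcVertex q len x = i
  · exact h3 ⟨x, hx⟩
  · exact hC x hx

theorem isStringFamily_of_mem (hR : StandardRep R N j) {Γ : Type} {q : Γ → ZMod n} {len : Γ → ℕ}
    {w : Γ → β → ℕ → k} (h : ∀ g, w g ∈ LinearMap.range (hR.emb (CyclicQuiver.vertex (q g))))
    (h' : ∀ g, (shift k β ^ len g) (w g) = 0) : IsStringFamily j q len w := by
  intro g b r hne
  refine ⟨?_, ((hR.mem_range _ _).1 (h g) b r hne).2⟩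
  by_contra hlt
  apply hne
  have := congrFun (congrFun (h' g) b) (r - len g)
  rwa [shift_pow_apply, Nat.sub_add_cancel (not_lt.1 hlt)] at this

theorem StandardRep.topologicalKrullDim_le [NeZero n] [Infinite k] [Fintype β] {ω κ : ℕ}
    (hω : 1 ≤ ω) (hR : StandardRep R (ω * n) j) {e : CyclicQuiver n → ℕ} (he : ∀ i, e i = ω * κ)
    (hκ : κ ≤ Fintype.card β) :
    topologicalKrullDim (R.Grassmannian e) ≤ ((ω * κ * (Fintype.card β - κ) : ℕ) : ℕ∞) := by
  refine iSup_le fun c => ?_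
  norm_cast
  by_contra! hlt
  obtain ⟨ν, _, y, hν, hy⟩ := QuiverRep.Grassmannian.exists_algIndep_of_chain c
  -- Isomorphism types are multiplicity functions `a`. Multiplicities are at most the dimension `ω
  -- κ`, so there are finitely many; those with the wrong dimension vector get the relation `1`.
  have key : ∀ a : ZMod n × Fin (ω * n) → Fin (ω * κ + 1), ∃ P : MvPolynomial ν k, P ≠ 0 ∧
      ((∀ i, (Finset.univ.filter fun x : ArcPoint (ArcType.length (c := fun x => a x)) =>
        arcVertex ArcType.start ArcType.length x = i).card = ω * κ) →
      ∀ (F : ∀ i, Fin (e i) → R.V i) (w : ArcType (fun x => a x) → β → ℕ → k),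
        IsStringFamily j ArcType.start ArcType.length w →
        StringIndependent ArcType.start ArcType.length w →
        (∀ i t, hR.emb i (F i t) ∈ Submodule.span k
          ((fun x : ArcPoint ArcType.length => (shift k β ^ (x.2 : ℕ)) (w x.1)) ''
            {x | arcVertex ArcType.start ArcType.length x = i.idx})) →
        evalFrame F (MvPolynomial.aeval y P) = 0) := by
    intro a
    by_cases hK : ∀ i, (Finset.univ.filter fun x : ArcPoint (ArcType.length (c := fun x => a x)) =>
        arcVertex ArcType.start ArcType.length x = i).card = ω * κ
    · have h1 := mul_card_le_of_string_count hω (fun g => g.1.2.2) hK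
      obtain ⟨P, hP, hP'⟩ := exists_relation_of_arcs hR he hK y (by
        rw [hν]
        obtain ⟨d, hd⟩ := Nat.exists_eq_add_of_le hκ
        rw [hd, Nat.add_sub_cancel_left] at hlt
        rw [hd]
        -- With `d = card β - κ`: `dim Hom(U, M)` exceeds the claimed bound by exactly `ω κ²`, which
        -- `dim End U` compensates.
        have : (κ + d) * (ω * κ) = ω * κ * d + ω * κ ^ 2 := by ring
        omega)
      exact ⟨P, hP, fun _ => hP'⟩
    · exact ⟨1, one_ne_zero, fun h => absurd h hK⟩
  choose P hP hP' using key
  have hprod : (∏ a, P a) ≠ 0 := Finset.prod_ne_zero_iff.2 fun a _ => hP a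
  refine hprod (hy _ fun U _ F hF => ?_)
  set W : ZMod n → Submodule k (β → ℕ → k) := fun i =>
    (U.1.1 (CyclicQuiver.vertex i)).map (hR.emb (CyclicQuiver.vertex i)) with hW
  have hfd : ∀ i, FiniteDimensional k (U.1.1 i) := fun i => (U.1.2 i).1
  have hWfd : ∀ i, FiniteDimensional k (W i) := fun i => by
    have := hfd (CyclicQuiver.vertex i)
    exact Module.Finite.map _ _
  have hWrank : ∀ i, Module.finrank k (W i) = ω * κ := fun i => by
    rw [← he (CyclicQuiver.vertex i), ← (U.1.2 (CyclicQuiver.vertex i)).2]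
    exact (Submodule.equivMapOfInjective _ (hR.injective _) _).finrank_eq.symm
  obtain ⟨a, v, ha, hv, hspan, hcard⟩ := exists_string_generators (A := shift k β) (U := W)
    (hR.map_shift_le U.2) (N := ω * n) (by
      rintro i _ ⟨x, -, rfl⟩
      exact hR.pow_eq_zero x)
  rw [evalFrame_aeval, map_prod]
  refine Finset.prod_eq_zero (Finset.mem_univ fun x => ⟨a x, by
    have := ha x
    rw [hWrank] at this
    omega⟩) ?_
  rw [← evalFrame_aeval]
  refine hP' _ (fun i => (hcard i).trans (hWrank i)) F.1 v
    (isStringFamily_of_mem hR (fun g => ?_) fun g => (hv g).2)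
    (stringIndependent_of_card hspan hcard) fun i t => hspan i.idx ?_
  · obtain ⟨x, -, hx⟩ := (hv g).1
    exact ⟨x, hx⟩
  · refine ⟨F.1 i t, ?_, rfl⟩
    rw [← hF]
    exact Submodule.subset_span (Set.mem_range_self t)

end UpperBound

/-! ### The lower bound -/

section Dimension

universe w u

variable {k : Type u} [Field k] {n : ℕ} {β : Type} {j : β → ZMod n}
  {R : QuiverRep.{w} k (CyclicQuiver n)}

theorem card_points [NeZero n] [Fintype β] {ω : ℕ} (q : ZMod n) :
    Fintype.card {x : β × Fin (ω * n) // q + ((x.2 : ℕ) : ZMod n) = j x.1} =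
      ω * Fintype.card β := by
  rw [Fintype.card_subtype, Finset.card_filter, Fintype.sum_prod_type]
  simp only [← Finset.card_filter, ← eq_sub_iff_add_eq', card_filter_natCast_eq, Finset.sum_const,
    Finset.card_univ, smul_eq_mul]
  rw [mul_comm]

theorem StandardRep.exists_equiv {N : ℕ} (hR : StandardRep R N j) (q : CyclicQuiver n) :
    Nonempty (R.V q ≃ₗ[k] ({x : β × Fin N // q.idx + ((x.2 : ℕ) : ZMod n) = j x.1} → k)) := by
  refine ⟨LinearEquiv.ofBijective
    { toFun x y := hR.emb q x y.1.1 y.1.2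
      map_add' x x' := by
        ext y
        simp
      map_smul' c x := by
        ext y
        simp } ⟨?_, ?_⟩⟩
  · rw [← LinearMap.ker_eq_bot, LinearMap.ker_eq_bot']
    intro x hx
    refine (map_eq_zero_iff _ (hR.injective q)).1 ?_
    ext b r
    by_contra hne
    obtain ⟨h1, h2⟩ := (hR.mem_range q _).1 ⟨x, rfl⟩ b r hne
    exact hne (congrFun hx ⟨(b, ⟨r, h1⟩), h2⟩)
  · intro f
    obtain ⟨x, hx⟩ := (hR.mem_range q fun b r => if h : ∃ hr : r < N, q.idx + (r : ZMod n) = j b then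
      f ⟨(b, ⟨r, h.1⟩), h.2⟩ else 0).2 (fun b r hne => by
        split_ifs at hne with h
        · exact ⟨h.1, h.2⟩
        · exact absurd rfl hne)
    refine ⟨x, ?_⟩
    ext ⟨⟨b, r⟩, h⟩
    simp only [LinearMap.coe_mk, AddHom.coe_mk, hx]
    rw [dif_pos ⟨r.2, h⟩]

theorem StandardRep.finiteDimensional [Finite β] {N : ℕ} (hR : StandardRep R N j)
    (q : CyclicQuiver n) :
    FiniteDimensional k (R.V q) := by
  obtain ⟨f⟩ := hR.exists_equiv q
  exact f.symm.finiteDimensional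

theorem StandardRep.dimVec_eq [NeZero n] [Fintype β] {ω : ℕ} (hR : StandardRep R (ω * n) j)
    (q : CyclicQuiver n) :
    R.dimVec q = ω * Fintype.card β := by
  obtain ⟨f⟩ := hR.exists_equiv q
  rw [QuiverRep.dimVec, f.finrank_eq, Module.finrank_fintype_fun_eq_card, card_points]

end Dimension

/-! ### Graphs of homomorphisms between sums of strings -/

section Graph

universe w u

variable {k : Type u} [Field k] {n : ℕ} {β β' : Type} {j : β → ZMod n}
  {j' : β' → ZMod n} {N : ℕ}

variable (j j' N) in
/-- The coordinates of the homomorphisms between sums of strings of length `N`. -/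
abbrev HomCoord : Type := {x : (β × β') × Fin N // j x.1.1 + 1 + ((x.2 : ℕ) : ZMod n) = j' x.1.2}

/-- The images of the generators. -/
def homGen : (HomCoord j j' N → k) →ₗ[k] (β → β' → ℕ → k) where
  toFun h s b r := if hr : ∃ hr : r < N, j s + 1 + (r : ZMod n) = j' b then
    h ⟨((s, b), ⟨r, hr.1⟩), hr.2⟩ else 0
  map_add' v v' := by
    ext g b r
    simp only [Pi.add_apply]
    split_ifs <;> simp
  map_smul' c v := by
    ext g b r
    simp only [Pi.smul_apply, RingHom.id_apply]
    split_ifs <;> simp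

theorem homGen_ne_zero {h : HomCoord j j' N → k} {s : β} {b : β'} {r : ℕ}
    (hne : homGen h s b r ≠ 0) : r < N ∧ j s + 1 + (r : ZMod n) = j' b := by
  simp only [homGen, LinearMap.coe_mk, AddHom.coe_mk] at hne
  split_ifs at hne with h'
  · exact ⟨h'.1, h'.2⟩
  · exact absurd rfl hne

variable {X Y : QuiverRep.{w} k (CyclicQuiver n)}

theorem StandardRep.eq_zero_of_le (hX : StandardRep X N j) {q : CyclicQuiver n} (x : X.V q)
    (s : β) (r : ℕ) (hr : N ≤ r) : hX.emb q x s r = 0 := by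
  by_contra hne
  have := ((hX.mem_range q _).1 ⟨x, rfl⟩ s r hne).1
  omega

variable [Fintype β]

/-- The homomorphism with given images of the generators. -/
def homMap (h : HomCoord j j' N → k) : (β → ℕ → k) →ₗ[k] (β' → ℕ → k) where
  -- The first vector of string `s` has coordinate `N - 1` and, as `n` divides `N` in the
  -- application, lives at `j s + 1`. The basis vector `(s, r)` is its shift by `N - 1 - r`.
  toFun f b r' := ∑ s, ∑ r ∈ Finset.range N, f s r * homGen h s b (r' + (N - 1 - r))
  map_add' f f' := by
    ext b r'
    simp [add_mul, Finset.sum_add_distrib]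
  map_smul' c f := by
    ext b r'
    simp [mul_assoc, Finset.mul_sum]

theorem homMap_apply (h : HomCoord j j' N → k) (f : β → ℕ → k) (b : β') (r' : ℕ) :
    homMap h f b r' = ∑ s, ∑ r ∈ Finset.range N, f s r * homGen h s b (r' + (N - 1 - r)) := rfl

theorem homMap_add (h h' : HomCoord j j' N → k) (f : β → ℕ → k) :
    homMap (h + h') f = homMap h f + homMap h' f := by
  ext b r'
  simp [homMap_apply, mul_add, Finset.sum_add_distrib]

theorem homMap_smul (c : k) (h : HomCoord j j' N → k) (f : β → ℕ → k) :
    homMap (c • h) f = c • homMap h f := by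
  ext b r'
  simp [homMap_apply, Finset.mul_sum, mul_left_comm]

/-- After reindexing only two boundary terms differ, and both vanish: the image of a generator has
no coordinate beyond `N - 1`, and neither does `f`. Hence images of generators are unrestricted. -/
theorem homMap_shift (h : HomCoord j j' N → k) {f : β → ℕ → k}
    (hf : ∀ s r, N ≤ r → f s r = 0) : homMap h (shift k β f) = shift k β' (homMap h f) := by
  ext b r'
  rw [shift_apply, homMap_apply, homMap_apply]
  refine Finset.sum_congr rfl fun s _ => ?_
  rcases N with _ | N
  · simp
  rw [Finset.sum_range_succ, Finset.sum_range_succ']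
  have h1 : homGen h s b (r' + 1 + (N + 1 - 1 - 0)) = 0 := by
    by_contra hne
    have := (homGen_ne_zero hne).1
    omega
  rw [h1, shift_apply, hf s (N + 1) le_rfl, zero_mul, mul_zero]
  congr 1
  refine Finset.sum_congr rfl fun r hr => ?_
  rw [Finset.mem_range] at hr
  rw [shift_apply, show r' + 1 + (N + 1 - 1 - (r + 1)) = r' + (N + 1 - 1 - r) by omega]

theorem homMap_mem_range (hX : StandardRep X N j) (hY : StandardRep Y N j')
    (hN : (N : ZMod n) = 0) (h : HomCoord j j' N → k) {q : CyclicQuiver n} (x : X.V q) :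
    homMap h (hX.emb q x) ∈ LinearMap.range (hY.emb q) := by
  rw [hY.mem_range]
  intro b r' hne
  rw [homMap_apply] at hne
  obtain ⟨s, -, hs⟩ := Finset.exists_ne_zero_of_sum_ne_zero hne
  obtain ⟨r, hr, hr'⟩ := Finset.exists_ne_zero_of_sum_ne_zero hs
  rw [Finset.mem_range] at hr
  obtain ⟨-, h2⟩ := (hX.mem_range q _).1 ⟨x, rfl⟩ s r (left_ne_zero_of_mul hr')
  obtain ⟨h3, h4⟩ := homGen_ne_zero (right_ne_zero_of_mul hr')
  refine ⟨by omega, ?_⟩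
  rw [← h4, ← h2, Nat.cast_add, Nat.cast_sub (by omega), Nat.cast_sub (by omega), hN]
  push_cast
  ring

/-- The graph of a homomorphism at a vertex, as a linear map on the domain. -/
noncomputable def graphMap (hX : StandardRep X N j) (D : ∀ q, (β' → ℕ → k) →ₗ[k] Y.V q)
    (h : HomCoord j j' N → k) (q : CyclicQuiver n) : X.V q →ₗ[k] (X.prod Y).V q :=
  LinearMap.prod LinearMap.id (D q ∘ₗ homMap h ∘ₗ hX.emb q)

variable {e : CyclicQuiver n → ℕ}

/-- The frame of the graph of a homomorphism. -/
noncomputable def graphFrame (hX : StandardRep X N j) (D : ∀ q, (β' → ℕ → k) →ₗ[k] Y.V q)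
    (B : ∀ q, Module.Basis (Fin (e q)) k (X.V q)) (h : HomCoord j j' N → k) :
    MultiFrame k (X.prod Y).V e :=
  ⟨fun q t => graphMap hX D h q (B q t), fun q =>
    (B q).linearIndependent.map' (graphMap hX D h q) (LinearMap.ker_eq_bot.2
      fun _ _ hxy => congrArg Prod.fst hxy)⟩

theorem span_graphFrame (hX : StandardRep X N j) (D : ∀ q, (β' → ℕ → k) →ₗ[k] Y.V q)
    (B : ∀ q, Module.Basis (Fin (e q)) k (X.V q)) (h : HomCoord j j' N → k)
    (q : CyclicQuiver n) :
    (graphFrame hX D B h).span.1 q = LinearMap.range (graphMap hX D h q) := by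
  change Submodule.span k (Set.range (graphMap hX D h q ∘ B q)) = _
  rw [Set.range_comp, Submodule.span_image, (B q).span_eq, Submodule.map_top]

/-- The point of the quiver Grassmannian given by the graph of a homomorphism. -/
noncomputable def graphPoint (hX : StandardRep X N j) (hY : StandardRep Y N j')
    (hN : (N : ZMod n) = 0) {D : ∀ q, (β' → ℕ → k) →ₗ[k] Y.V q}
    (hD : ∀ q x, D q (hY.emb q x) = x) (B : ∀ q, Module.Basis (Fin (e q)) k (X.V q)) (h : HomCoord j j' N → k) :
    (X.prod Y).Grassmannian e :=
  ⟨(graphFrame hX D B h).span, by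
    intro i i' α
    obtain rfl : CyclicQuiver.vertex (i.idx + 1) = i' := α.down
    rw [span_graphFrame, span_graphFrame]
    rintro _ ⟨_, ⟨x, rfl⟩, rfl⟩
    refine ⟨X.map (CyclicQuiver.arrow i) x, Prod.ext rfl ?_⟩
    apply hY.injective
    obtain ⟨y, hy⟩ := homMap_mem_range hX hY hN h x
    obtain ⟨y', hy'⟩ := homMap_mem_range hX hY hN h (X.map (CyclicQuiver.arrow i) x)
    change hY.emb _ (D _ (homMap h (hX.emb _ (X.map (CyclicQuiver.arrow i) x)))) =
      hY.emb _ (Y.map (CyclicQuiver.arrow i) (D _ (homMap h (hX.emb _ x))))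
    rw [hY.map, ← hy', ← hy, hD, hD, hy', hy, hX.map, homMap_shift h (hX.eq_zero_of_le x)]⟩

theorem isPolyFun_graphFrame [Finite β'] (hX : StandardRep X N j)
    (D : ∀ q, (β' → ℕ → k) →ₗ[k] Y.V q) (B : ∀ q, Module.Basis (Fin (e q)) k (X.V q))
    (p : MvPolynomial (Module.Dual k (∀ i, Fin (e i) → (X.prod Y).V i)) k) :
    IsPolyFun fun h : HomCoord j j' N → k => evalFrame (graphFrame hX D B h).1 p := by
  refine IsPolyFun.eval (w := fun h (φ : Module.Dual k (∀ i, Fin (e i) → (X.prod Y).V i)) =>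
    φ (graphFrame hX D B h).1) (fun φ => ?_) p
  let L : (HomCoord j j' N → k) →ₗ[k] ∀ i, Fin (e i) → (X.prod Y).V i :=
    { toFun h := fun q t => ((0 : X.V q), D q (homMap h (hX.emb q (B q t))))
      map_add' h h' := by
        funext q t
        refine Prod.ext (add_zero (0 : X.V q)).symm ?_
        change D q _ = D q _ + D q _
        rw [homMap_add, map_add]
      map_smul' c h := by
        funext q t
        refine Prod.ext (smul_zero (A := X.V q) c).symm ?_
        change D q _ = c • D q _
        rw [homMap_smul, map_smul] }
  let F₀ : ∀ i, Fin (e i) → (X.prod Y).V i := fun q t => (B q t, (0 : Y.V q))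
  have h1 : ∀ h, φ (graphFrame hX D B h).1 = φ F₀ + (φ ∘ₗ L) h := by
    intro h
    rw [LinearMap.comp_apply, ← map_add]
    congr 1
    funext q t
    exact Prod.ext (add_zero (B q t)).symm (zero_add _).symm
  rw [funext h1]
  exact (IsPolyFun.const _).add (IsPolyFun.linear _)

/-- Graphs depend polynomially on the homomorphism, and a coordinate subspace of affine space over
an infinite field is irreducible. -/
theorem isPreirreducible_graphPoint [Infinite k] [Finite β'] (hX : StandardRep X N j)
    (hY : StandardRep Y N j') (hN : (N : ZMod n) = 0)
    {D : ∀ q, (β' → ℕ → k) →ₗ[k] Y.V q} (hD : ∀ q x, D q (hY.emb q x) = x)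
    (B : ∀ q, Module.Basis (Fin (e q)) k (X.V q)) (S : Set (HomCoord j j' N)) :
    IsPreirreducible (graphPoint hX hY hN hD B '' {h : HomCoord j j' N → k | ∀ x ∉ S, h x = 0}) := by
  classical
  rw [isPreirreducible_iff_isClosed_union_isClosed]
  intro Z Z' hZ hZ' hsub
  by_contra! hcon
  obtain ⟨C, ⟨P, hP⟩, hC⟩ := QuiverRep.Grassmannian.isClosed_iff.1 hZ
  obtain ⟨C', ⟨P', hP'⟩, hC'⟩ := QuiverRep.Grassmannian.isClosed_iff.1 hZ'
  have hmem : ∀ h, graphPoint hX hY hN hD B h ∈ Z ↔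
      ∀ p ∈ P, evalFrame (graphFrame hX D B h).1 p = 0 :=
    fun h => (hC _).trans (hP (graphFrame hX D B h))
  have hmem' : ∀ h, graphPoint hX hY hN hD B h ∈ Z' ↔
      ∀ p ∈ P', evalFrame (graphFrame hX D B h).1 p = 0 :=
    fun h => (hC' _).trans (hP' (graphFrame hX D B h))
  simp only [Set.not_subset] at hcon
  obtain ⟨⟨_, ⟨h₁, hh₁, rfl⟩, h1⟩, ⟨_, ⟨h₂, hh₂, rfl⟩, h2⟩⟩ := hcon
  simp only [hmem, not_forall] at h1
  simp only [hmem', not_forall] at h2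
  obtain ⟨p, hp, hp0⟩ := h1
  obtain ⟨p', hp', hp0'⟩ := h2
  let pr : (HomCoord j j' N → k) → (HomCoord j j' N → k) := fun h x => if x ∈ S then h x else 0
  have hpr : ∀ h, (∀ x ∉ S, h x = 0) → pr h = h := by
    intro h hh
    funext x
    simp only [pr]
    split_ifs with hx
    · rfl
    · exact (hh x hx).symm
  have hpoly : ∀ x, IsPolyFun fun h => pr h x := fun x => (IsPolyFun.coord x).ite (IsPolyFun.const 0)
  apply hp0
  rw [← hpr h₁ hh₁]
  refine IsPolyFun.eq_zero_of_mul ((isPolyFun_graphFrame hX D B p).comp hpoly)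
    ((isPolyFun_graphFrame hX D B p').comp hpoly) (fun h => ?_) (x₀ := h₂)
    (by rw [hpr h₂ hh₂]; exact hp0') h₁
  rcases hsub ⟨pr h, fun x hx => if_neg hx, rfl⟩ with h3 | h3
  · rw [(hmem _).1 h3 p hp, zero_mul]
  · rw [(hmem' _).1 h3 p' hp', mul_zero]

/-- The closed set where a coordinate of a homomorphism vanishes. -/
theorem exists_isClosed_coord (hX : StandardRep X N j) (hY : StandardRep Y N j')
    (hN : (N : ZMod n) = 0) {D : ∀ q, (β' → ℕ → k) →ₗ[k] Y.V q}
    (hD : ∀ q x, D q (hY.emb q x) = x) (B : ∀ q, Module.Basis (Fin (e q)) k (X.V q))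
    (x : HomCoord j j' N) : ∃ Z : Set ((X.prod Y).Grassmannian e), IsClosed Z ∧
      ∀ h : HomCoord j j' N → k, graphPoint hX hY hN hD B h ∈ Z ↔ h x = 0 := by
  classical
  obtain ⟨⟨⟨s, b⟩, r⟩, hx⟩ := x
  have hNpos : 0 < N := (Nat.zero_le _).trans_lt r.2
  set q : CyclicQuiver n := CyclicQuiver.vertex (j s + 1) with hq
  -- The generator of string `s`; the coordinate `x` of `h` is the `(b, r)` coordinate of its image.
  obtain ⟨g, hg⟩ : Pi.single s (Pi.single (N - 1) 1) ∈ LinearMap.range (hX.emb q) := by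
    rw [hX.mem_range]
    intro s' r' hne
    by_cases hs : s' = s
    · subst hs
      by_cases hr : r' = N - 1
      · subst hr
        refine ⟨by omega, ?_⟩
        rw [hq, CyclicQuiver.idx_vertex, Nat.cast_sub hNpos, hN]
        push_cast
        ring
      · simp [hr] at hne
    · simp [hs] at hne
  have hhom : ∀ h : HomCoord j j' N → k,
      homMap h (hX.emb q g) b r = h ⟨((s, b), r), hx⟩ := by
    intro h
    rw [hg, homMap_apply, Finset.sum_eq_single s, Finset.sum_eq_single (N - 1)]
    · simp only [Pi.single_eq_same, one_mul, Nat.sub_self, add_zero]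
      change (if hr : ∃ hr : (r : ℕ) < N, j s + 1 + ((r : ℕ) : ZMod n) = j' b then
        h ⟨((s, b), ⟨r, hr.1⟩), hr.2⟩ else 0) = _
      rw [dif_pos ⟨r.2, hx⟩]
    · intro r' _ hr'
      simp [hr']
    · intro hn
      exact absurd (Finset.mem_range.2 (by omega)) hn
    · intro s' _ hs'
      simp [hs']
    · simp
  let μ : X.V q →ₗ[k] k := LinearMap.proj (N - 1) ∘ₗ LinearMap.proj s ∘ₗ hX.emb q
  have hμ : μ g = 1 := by simp [μ, hg]
  let lam : Y.V q →ₗ[k] k := LinearMap.proj (r : ℕ) ∘ₗ LinearMap.proj b ∘ₗ hY.emb q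
  have hlam : ∀ (h : HomCoord j j' N → k) z,
      lam (D q (homMap h (hX.emb q z))) = homMap h (hX.emb q z) b r := by
    intro h z
    obtain ⟨y, hy⟩ := homMap_mem_range hX hY hN h z
    simp only [lam, LinearMap.comp_apply, LinearMap.proj_apply]
    rw [← hy, hD]
  -- On the graph of `h`, `θ` is the identity plus a rank one map with image in the line of `g`, and
  -- its determinant is `1 + (h x - 1) = h x`. So the coordinate vanishes exactly if `θ` is singular
  -- on the subspace, a condition independent of the frame.
  let θ : (X.prod Y).V q →ₗ[k] X.V q :=
    { toFun z := z.1 + (lam z.2 - μ z.1) • g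
      map_add' z z' := by
        change (z.1 + z'.1) + (lam (z.2 + z'.2) - μ (z.1 + z'.1)) • g = _
        rw [map_add, map_add]
        module
      map_smul' c z := by
        change c • z.1 + (lam (c • z.2) - μ (c • z.1)) • g = c • (z.1 + (lam z.2 - μ z.1) • g)
        rw [map_smul, map_smul, smul_eq_mul, smul_eq_mul]
        module }
  have hθ : ∀ (h : HomCoord j j' N → k) z,
      θ (graphMap hX D h q z) = z + (homMap h (hX.emb q z) b r - μ z) • g := by
    intro h z
    rw [← hlam]
    rfl
  have hg0 : g ≠ 0 := by
    rintro rfl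
    simp at hμ
  let p : MvPolynomial (Module.Dual k (∀ i, Fin (e i) → (X.prod Y).V i)) k :=
    Matrix.det (Matrix.of fun t' t => MvPolynomial.X
      ((B q).coord t' ∘ₗ θ ∘ₗ LinearMap.proj t ∘ₗ LinearMap.proj q))
  have hp : ∀ F : ∀ i, Fin (e i) → (X.prod Y).V i,
      evalFrame F p = Matrix.det (Matrix.of fun t' t => (B q).repr (θ (F q t)) t') := by
    intro F
    simp only [p, RingHom.map_det]
    congr 1
    ext t' t
    simp [evalFrame]
  refine ⟨QuiverRep.Grassmannian.zeroFibers p, QuiverRep.Grassmannian.isClosed_zeroFibers p,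
    fun h => ⟨fun hmem => ?_, fun h0 F hF => ?_⟩⟩
  · by_contra hne
    have h1 := hmem (graphFrame hX D B h) rfl
    rw [hp] at h1
    obtain ⟨c, hc, hc0⟩ := Matrix.exists_mulVec_eq_zero_iff.2 h1
    apply hc
    set z : X.V q := ∑ t, c t • B q t with hz
    have h2 : θ (graphMap hX D h q z) = 0 := by
      apply (B q).repr.injective
      ext t'
      rw [hz]
      simp only [map_sum, map_smul, map_zero, Finsupp.coe_finsetSum, Finset.sum_apply,
        Finsupp.smul_apply, smul_eq_mul, Finsupp.coe_zero, Pi.zero_apply]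
      have := congrFun hc0 t'
      simp only [Matrix.mulVec, dotProduct, Matrix.of_apply, Pi.zero_apply] at this
      rw [← this]
      exact Finset.sum_congr rfl fun t _ => mul_comm _ _
    rw [hθ] at h2
    set a : k := homMap h (hX.emb q z) b r - μ z with ha
    have h3 : z = (-a) • g := by rw [neg_smul]; exact eq_neg_of_add_eq_zero_left h2
    have h4 : a = (-a) * (h ⟨((s, b), r), hx⟩ - 1) := by
      conv_lhs => rw [ha, h3]
      simp only [map_smul, Pi.smul_apply, smul_eq_mul, hhom, hμ]
      ring
    have h5 : a * h ⟨((s, b), r), hx⟩ = 0 := by linear_combination h4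
    have h6 : a = 0 := (mul_eq_zero.1 h5).resolve_right hne
    rw [h6, neg_zero, zero_smul, hz] at h3
    exact funext (Fintype.linearIndependent_iff.1 (B q).linearIndependent c h3)
  · rw [hp]
    have h1 : graphMap hX D h q g ∈ Submodule.span k (Set.range (F.1 q)) := by
      have h2 : Submodule.span k (Set.range (F.1 q)) = (graphFrame hX D B h).span.1 q :=
        congrFun (congrArg Subtype.val hF) q
      rw [h2, span_graphFrame]
      exact ⟨g, rfl⟩
    obtain ⟨c, hc⟩ := (Submodule.mem_span_range_iff_exists_fun k).1 h1
    refine Matrix.exists_mulVec_eq_zero_iff.1 ⟨c, ?_, ?_⟩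
    · rintro rfl
      simp only [Pi.zero_apply, zero_smul, Finset.sum_const_zero] at hc
      exact hg0 (congrArg Prod.fst hc).symm
    · have h2 : θ (graphMap hX D h q g) = 0 := by
        rw [hθ, hhom, h0, hμ]
        module
      rw [← hc, map_sum] at h2
      funext t'
      have h3 := congrArg (fun z => (B q).repr z t') h2
      simp only [map_smul, map_sum, Finsupp.coe_finsetSum, Finset.sum_apply, Finsupp.smul_apply,
        smul_eq_mul, map_zero, Finsupp.coe_zero, Pi.zero_apply] at h3
      simp only [Matrix.mulVec, dotProduct, Matrix.of_apply, Pi.zero_apply]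
      rw [← h3]
      exact Finset.sum_congr rfl fun t _ => mul_comm _ _

theorem card_homCoord [NeZero n] [Fintype β'] {ω : ℕ} :
    Fintype.card (HomCoord j j' (ω * n)) = ω * Fintype.card β * Fintype.card β' := by
  rw [Fintype.card_subtype, Finset.card_filter, Fintype.sum_prod_type]
  simp only [← Finset.card_filter, ← eq_sub_iff_add_eq', card_filter_natCast_eq, Finset.sum_const,
    Finset.card_univ, smul_eq_mul, Fintype.card_prod]
  ring

/-- Freeing the coordinates of a homomorphism one at a time gives a chain of irreducible closures.
It is strict because the vanishing of the next coordinate is a closed condition that the smaller set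
satisfies and the larger does not. -/
theorem le_topologicalKrullDim_prod [Infinite k] [Fintype β'] (hX : StandardRep X N j)
    (hY : StandardRep Y N j') (hN : (N : ZMod n) = 0)
    (B : ∀ q, Module.Basis (Fin (e q)) k (X.V q)) :
    ((Fintype.card (HomCoord j j' N) : ℕ) : ℕ∞) ≤
      topologicalKrullDim ((X.prod Y).Grassmannian e) := by
  classical
  choose D hD using fun i => LinearMap.exists_leftInverse_of_injective (hY.emb i)
    (LinearMap.ker_eq_bot.2 (hY.injective i))
  have hD' : ∀ q x, D q (hY.emb q x) = x := fun i x => LinearMap.congr_fun (hD i) x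
  let en := Fintype.equivFin (HomCoord j j' N)
  let Z : Fin (Fintype.card (HomCoord j j' N) + 1) → Set ((X.prod Y).Grassmannian e) := fun i =>
    graphPoint hX hY hN hD' B ''
      {h : HomCoord j j' N → k | ∀ x ∉ {x | (en x : ℕ) < i}, h x = 0}
  have hirr : ∀ i, IsIrreducible (closure (Z i)) := fun i =>
    ⟨⟨_, subset_closure ⟨0, fun _ _ => rfl, rfl⟩⟩,
      (isPreirreducible_graphPoint hX hY hN hD' B _).closure⟩
  let c : Fin (Fintype.card (HomCoord j j' N) + 1) →
      TopologicalSpace.IrreducibleCloseds ((X.prod Y).Grassmannian e) :=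
    fun i => ⟨closure (Z i), hirr i, isClosed_closure⟩
  have hstep : ∀ i : Fin (Fintype.card (HomCoord j j' N)), c i.castSucc < c i.succ := by
    intro i
    refine lt_of_le_not_ge ?_ fun hle => ?_
    · refine closure_mono (Set.image_mono fun h hh x hx => hh x fun hx' => hx ?_)
      simp only [Set.mem_ofPred_eq, Fin.val_castSucc, Fin.val_succ] at hx' ⊢
      omega
    · obtain ⟨C, hC, hCmem⟩ := exists_isClosed_coord hX hY hN hD' B (en.symm i)
      have h1 : Z i.castSucc ⊆ C := by
        rintro _ ⟨h, hh, rfl⟩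
        rw [hCmem]
        exact hh _ (by simp)
      have h2 : graphPoint hX hY hN hD' B (Pi.single (en.symm i) 1) ∈ Z i.succ := by
        refine ⟨_, fun x hx => ?_, rfl⟩
        rw [Pi.single_eq_of_ne]
        rintro rfl
        simp at hx
      have h3 := closure_minimal h1 hC (hle (subset_closure h2))
      rw [hCmem] at h3
      simp at h3
  exact Order.LTSeries.length_le_krullDim
    (⟨Fintype.card (HomCoord j j' N), c, hstep⟩ : LTSeries (TopologicalSpace.IrreducibleCloseds _))

end Graph

/-! ### Projective and injective representations -/

namespace CyclicQuiver

variable {n : ℕ}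

theorem idx_add_length {i l : CyclicQuiver n} (p : Quiver.Path i l) :
    i.idx + (p.length : ZMod n) = l.idx := by
  induction p with
  | nil => simp
  | @cons b c p α ih =>
    have hα : b.idx + 1 = c.idx := α.down
    rw [Quiver.Path.length_cons, Nat.cast_succ, ← add_assoc, ih, hα]

theorem exists_path (i : CyclicQuiver n) (r : ℕ) {l : CyclicQuiver n}
    (h : i.idx + (r : ZMod n) = l.idx) : ∃ p : Quiver.Path i l, p.length = r := by
  induction r generalizing l with
  | zero =>
    rw [Nat.cast_zero, add_zero] at h
    obtain rfl : i = l := h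
    exact ⟨Quiver.Path.nil, rfl⟩
  | succ r ih =>
    obtain ⟨p, hp⟩ := ih (l := vertex (i.idx + (r : ZMod n))) rfl
    have h' : i.idx + (r : ZMod n) + 1 = l.idx := by rw [← h, Nat.cast_succ, add_assoc]
    exact ⟨p.cons ⟨h'⟩, by rw [Quiver.Path.length_cons, hp]⟩

theorem path_ext {i l : CyclicQuiver n} {p p' : Quiver.Path i l} (h : p.length = p'.length) :
    p = p' := by
  induction p with
  | nil =>
    exact (Quiver.Path.eq_nil_of_length_zero p' h.symm).symm
  | @cons b c p α ih =>
    cases p' with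
    | nil => simp at h
    | @cons b' _ p' α' =>
      have hα : b.idx + 1 = c.idx := α.down
      have hα' : b'.idx + 1 = c.idx := α'.down
      obtain rfl : b = b' := add_right_cancel (G := ZMod n) (hα.trans hα'.symm)
      rw [ih (Nat.succ_injective h)]
      exact congrArg p'.cons (PLift.down_injective rfl)

end CyclicQuiver

section Standard

universe w u

variable {k : Type u} [Field k] {n N : ℕ}

/-- A path on the cycle is determined by its source and length, so a path of length at least `N`
factors through the path of length `N` from its source. -/
theorem BoundQuiver.single_mem_ideal {i l : CyclicQuiver n} {p : Quiver.Path i l}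
    (hp : N ≤ p.length) (c : k) : Finsupp.single p c ∈ BoundQuiver.ideal k N i l := by
  obtain ⟨r, hr⟩ := CyclicQuiver.exists_path i N
    (l := CyclicQuiver.vertex (i.idx + (N : ZMod n))) rfl
  obtain ⟨s, hs⟩ := CyclicQuiver.exists_path (CyclicQuiver.vertex (i.idx + (N : ZMod n)))
    (p.length - N) (l := l) (by
      rw [← CyclicQuiver.idx_add_length p, CyclicQuiver.idx_vertex, Nat.cast_sub hp]
      ring)
  obtain rfl : (Quiver.Path.nil.comp r).comp s = p := CyclicQuiver.path_ext (by
    rw [Quiver.Path.length_comp, Quiver.Path.length_comp, Quiver.Path.length_nil]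
    omega)
  rw [← mul_one c, ← smul_eq_mul, ← Finsupp.smul_single]
  exact Submodule.smul_mem _ _ (Submodule.subset_span ⟨_, _, _, r, s, hr, rfl⟩)

theorem BoundQuiver.ideal_le_ker {i l : CyclicQuiver n} {M : Type*} [AddCommGroup M] [Module k M]
    {g : Quiver.Path i l → M} (hg : ∀ p, N ≤ p.length → g p = 0) :
    BoundQuiver.ideal k N i l ≤ LinearMap.ker (Finsupp.linearCombination k g) := by
  rw [BoundQuiver.ideal, Submodule.span_le]
  rintro _ ⟨a, b, p, r, s, hr, rfl⟩
  change Finsupp.linearCombination k g _ = 0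
  rw [Finsupp.linearCombination_single, hg, smul_zero]
  rw [Quiver.Path.length_comp, Quiver.Path.length_comp]
  omega

/-- The direct sum of two standard representations. -/
def StandardRep.prod {R S : QuiverRep.{w} k (CyclicQuiver n)} {β β' : Type} {j : β → ZMod n}
    {j' : β' → ZMod n} (hR : StandardRep R N j) (hS : StandardRep S N j') :
    StandardRep (R.prod S) N (Sum.elim j j') where
  emb q :=
    { toFun x := Sum.elim (hR.emb q x.1) (hS.emb q x.2)
      map_add' x y := by
        funext b
        rcases b with b | b
        · exact congrFun (map_add (hR.emb q) x.1 y.1) b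
        · exact congrFun (map_add (hS.emb q) x.2 y.2) b
      map_smul' c x := by
        funext b
        rcases b with b | b
        · exact congrFun (map_smul (hR.emb q) c x.1) b
        · exact congrFun (map_smul (hS.emb q) c x.2) b }
  injective q x y h := by
    refine Prod.ext (hR.injective q ?_) (hS.injective q ?_)
    · exact congrArg (fun f => f ∘ Sum.inl) h
    · exact congrArg (fun f => f ∘ Sum.inr) h
  mem_range q f := by
    constructor
    · rintro ⟨x, rfl⟩ (b | b) r hne
      · exact (hR.mem_range q _).1 ⟨x.1, rfl⟩ b r hne
      · exact (hS.mem_range q _).1 ⟨x.2, rfl⟩ b r hne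
    · intro h
      obtain ⟨x, hx⟩ := (hR.mem_range q (f ∘ Sum.inl)).2 fun b r => h (Sum.inl b) r
      obtain ⟨y, hy⟩ := (hS.mem_range q (f ∘ Sum.inr)).2 fun b r => h (Sum.inr b) r
      refine ⟨(x, y), ?_⟩
      change Sum.elim (hR.emb q x) (hS.emb q y) = f
      rw [hx, hy, Sum.elim_comp_inl_inr]
  map q x := by
    funext b
    rcases b with b | b
    · exact congrFun (hR.map q x.1) b
    · exact congrFun (hS.map q x.2) b

/-- A direct sum of strings is standard. -/
def StandardRep.pi {ι : Type} [Finite ι] {R : ι → QuiverRep.{w} k (CyclicQuiver n)}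
    {j : ι → ZMod n} (hR : ∀ s, StandardRep (R s) N fun _ : Unit => j s) :
    StandardRep (QuiverRep.pi R) N j where
  emb q :=
    { toFun x s := (hR s).emb q (x s) ()
      map_add' x y := by
        funext s
        exact congrFun (map_add ((hR s).emb q) (x s) (y s)) ()
      map_smul' c x := by
        funext s
        exact congrFun (map_smul ((hR s).emb q) c (x s)) () }
  injective q x y h := by
    funext s
    exact (hR s).injective q (funext fun _ => congrFun h s)
  mem_range q f := by
    constructor
    · rintro ⟨x, rfl⟩ s r hne
      exact ((hR s).mem_range q _).1 ⟨x s, rfl⟩ () r hne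
    · intro h
      choose x hx using fun s => ((hR s).mem_range q fun _ => f s).2 fun _ r => h s r
      exact ⟨x, funext fun s => congrFun (hx s) ()⟩
  map q x := by
    funext s
    exact congrFun ((hR s).map q (x s)) ()

/-- The coordinates of a path in a projective representation. -/
def pathCoord (k : Type u) [Field k] (N : ℕ) {i l : CyclicQuiver n} (p : Quiver.Path i l) :
    Unit → ℕ → k :=
  fun _ r => if r + p.length + 1 = N then 1 else 0

theorem pathCoord_eq_zero {i l : CyclicQuiver n} {p : Quiver.Path i l} (hp : N ≤ p.length) :
    pathCoord k N p = 0 := by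
  funext _ r
  exact if_neg (by omega)

/-- The projective representations are strings. -/
noncomputable def StandardRep.projective (hN : (N : ZMod n) = 0) (i : CyclicQuiver n) :
    StandardRep (BoundQuiver.projective k N i) N fun _ : Unit => i.idx - 1 where
  -- The last nonzero path from `i` has length `N - 1` and ends at `i - 1`; a path of length `d` is
  -- `N - 1 - d` steps before it.
  emb l := (BoundQuiver.ideal k N i l).liftQ (Finsupp.linearCombination k (pathCoord k N))
    (BoundQuiver.ideal_le_ker fun _ => pathCoord_eq_zero)
  injective l := by
    refine (injective_iff_map_eq_zero _).2 fun x hx => ?_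
    obtain ⟨f, rfl⟩ := Submodule.Quotient.mk_surjective _ x
    refine (Submodule.Quotient.mk_eq_zero _).2 ?_
    rw [← Finsupp.sum_single f]
    refine Submodule.sum_mem _ fun p _ => ?_
    rcases le_or_gt N p.length with hp | hp
    · exact BoundQuiver.single_mem_ideal hp _
    · have h1 : Finsupp.linearCombination k (pathCoord k N) f () (N - 1 - p.length) = 0 :=
        congrFun (congrFun hx ()) _
      rw [Finsupp.linearCombination_apply, Finsupp.sum, Finset.sum_apply, Finset.sum_apply,
        Finset.sum_eq_single p] at h1
      · have h2 : f p = 0 := by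
          simpa [pathCoord, show N - 1 - p.length + p.length + 1 = N by omega] using h1
        rw [h2, Finsupp.single_zero]
        exact Submodule.zero_mem _
      · intro p' _ hne
        have : ¬ N - 1 - p.length + p'.length + 1 = N := fun h =>
          hne (CyclicQuiver.path_ext (by omega))
        simp [pathCoord, this]
      · intro h
        simp [Finsupp.notMem_support_iff.1 h]
  mem_range l f := by
    constructor
    · rintro ⟨x, rfl⟩ b r hne
      obtain ⟨g, rfl⟩ := Submodule.Quotient.mk_surjective _ x
      change Finsupp.linearCombination k (pathCoord k N) g b r ≠ 0 at hne
      rw [Finsupp.linearCombination_apply, Finsupp.sum, Finset.sum_apply, Finset.sum_apply] at hne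
      obtain ⟨p, -, hp⟩ := Finset.exists_ne_zero_of_sum_ne_zero hne
      have h1 : r + p.length + 1 = N := by
        by_contra h
        simp [pathCoord, h] at hp
      refine ⟨by omega, ?_⟩
      have h2 : (r : ZMod n) + (p.length : ZMod n) + 1 = 0 := by
        rw [← hN, ← h1]
        push_cast
        ring
      rw [← CyclicQuiver.idx_add_length p]
      linear_combination h2
    · intro h
      have hf : f = ∑ r ∈ Finset.range N, fun _ => Pi.single r (f () r) := by
        funext b r
        rw [Finset.sum_apply, Finset.sum_apply]
        by_cases hr : r < N
        · rw [Finset.sum_eq_single r]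
          · simp
          · intro r' _ hne
            simp [hne.symm]
          · simp [hr]
        · rw [Finset.sum_eq_zero]
          · by_contra hne
            exact hr (h b r hne).1
          · intro r' hr'
            have hne : r ≠ r' := by
              rintro rfl
              exact hr (Finset.mem_range.1 hr')
            simp [hne]
      rw [hf]
      refine Submodule.sum_mem _ fun r hr => ?_
      rw [Finset.mem_range] at hr
      by_cases h0 : f () r = 0
      · simp only [h0, Pi.single_zero]
        exact Submodule.zero_mem _
      · have h1 := (h () r h0).2
        obtain ⟨p, hp⟩ := CyclicQuiver.exists_path i (N - 1 - r) (l := l) (by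
          rw [Nat.cast_sub (by omega), Nat.cast_sub (by omega), hN]
          push_cast
          linear_combination -h1)
        refine ⟨Submodule.Quotient.mk (Finsupp.single p (f () r)), ?_⟩
        change Finsupp.linearCombination k (pathCoord k N) (Finsupp.single p (f () r)) = _
        rw [Finsupp.linearCombination_single]
        funext b r'
        by_cases hr' : r' = r
        · subst hr'
          simp [pathCoord, show r' + p.length + 1 = N by omega]
        · simp [pathCoord, hr', show ¬ r' + p.length + 1 = N by omega]
  map l x := by
    obtain ⟨f, rfl⟩ := Submodule.Quotient.mk_surjective _ x
    change Finsupp.linearCombination k (pathCoord k N) (Finsupp.mapDomain _ f) =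
      shift k Unit (Finsupp.linearCombination k (pathCoord k N) f)
    rw [Finsupp.linearCombination_mapDomain, Finsupp.apply_linearCombination]
    congr 2
    funext p b r
    simp only [Function.comp_apply, shift_apply, pathCoord, Quiver.Path.length_cons]
    congr 2
    omega

open Classical in
/-- The coordinates of a functional on paths. -/
noncomputable def functionalCoord (N : ℕ) (l m : CyclicQuiver n) :
    Module.Dual k (BoundQuiver.PathSpace k N l m) →ₗ[k] (Unit → ℕ → k) where
  toFun φ _ r := if h : ∃ p : Quiver.Path l m, p.length = r then
    φ (Submodule.Quotient.mk (Finsupp.single h.choose 1)) else 0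
  map_add' φ ψ := by
    funext b r
    simp only [Pi.add_apply]
    split_ifs <;> simp
  map_smul' c φ := by
    funext b r
    simp only [Pi.smul_apply]
    split_ifs <;> simp

theorem functionalCoord_length {l m : CyclicQuiver n}
    (φ : Module.Dual k (BoundQuiver.PathSpace k N l m)) (b : Unit) (p : Quiver.Path l m) :
    functionalCoord N l m φ b p.length =
      φ (Submodule.Quotient.mk (Finsupp.single p 1)) := by
  have h : ∃ p' : Quiver.Path l m, p'.length = p.length := ⟨p, rfl⟩
  simp only [functionalCoord, LinearMap.coe_mk, AddHom.coe_mk, dif_pos h]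
  rw [CyclicQuiver.path_ext h.choose_spec]

theorem functionalCoord_of_forall_ne {l m : CyclicQuiver n}
    (φ : Module.Dual k (BoundQuiver.PathSpace k N l m)) (b : Unit) {r : ℕ}
    (h : ∀ p : Quiver.Path l m, p.length ≠ r) : functionalCoord N l m φ b r = 0 := by
  simp [functionalCoord, h]

/-- The injective representations are strings. -/
noncomputable def StandardRep.injectiveRep (m : CyclicQuiver n) :
    StandardRep (BoundQuiver.injective k N m) N fun _ : Unit => m.idx where
  -- Coordinate `r` is the value on the unique path of length `r` into `m`; transposing the
  -- concatenation with an arrow becomes the shift.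
  emb l := functionalCoord N l m
  injective l φ ψ h := by
    refine Submodule.linearMap_qext _ (Finsupp.lhom_ext' fun p => LinearMap.ext_ring ?_)
    exact ((functionalCoord_length φ () p).symm.trans (congrFun (congrFun h ()) p.length)).trans
      (functionalCoord_length ψ () p)
  mem_range l f := by
    constructor
    · rintro ⟨φ, rfl⟩ b r hne
      obtain ⟨p, rfl⟩ : ∃ p : Quiver.Path l m, p.length = r := by
        by_contra! h
        exact hne (functionalCoord_of_forall_ne φ b h)
      refine ⟨?_, CyclicQuiver.idx_add_length p⟩
      by_contra! hp
      refine hne ((functionalCoord_length φ b p).trans ?_)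
      rw [(Submodule.Quotient.mk_eq_zero _).2 (BoundQuiver.single_mem_ideal hp 1)]
      exact LinearMap.map_zero (M₃ := k) _
    · intro h
      refine ⟨(BoundQuiver.ideal k N l m).liftQ
        (Finsupp.linearCombination k fun p : Quiver.Path l m => f () p.length)
        (BoundQuiver.ideal_le_ker fun p hp => ?_), ?_⟩
      · by_contra hne
        have := (h () _ hne).1
        omega
      · funext b r
        by_cases hr : ∃ p : Quiver.Path l m, p.length = r
        · obtain ⟨p, rfl⟩ := hr
          refine (functionalCoord_length _ b p).trans ?_
          change Finsupp.linearCombination k (fun p : Quiver.Path l m => f () p.length)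
            (Finsupp.single p 1) = _
          rw [Finsupp.linearCombination_single, one_smul]
        · push Not at hr
          refine (functionalCoord_of_forall_ne _ b hr).trans ?_
          by_contra hne
          obtain ⟨p, hp⟩ := CyclicQuiver.exists_path l r (h b r (Ne.symm hne)).2
          exact hr p hp
  map l := fun φ : Module.Dual k (BoundQuiver.PathSpace k N l m) => by
    funext b r
    rw [shift_apply]
    by_cases hr : ∃ p : Quiver.Path (CyclicQuiver.vertex (l.idx + 1)) m, p.length = r
    · obtain ⟨p, rfl⟩ := hr
      refine (functionalCoord_length _ b p).trans ?_
      have h1 : p.length + 1 = ((CyclicQuiver.arrow l).toPath.comp p).length := by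
        rw [Quiver.Path.length_comp, Quiver.Path.length_toPath, add_comm]
      rw [h1]
      refine Eq.trans ?_ (functionalCoord_length φ b _).symm
      refine congrArg (fun f => φ (Submodule.Quotient.mk f)) ?_
      exact Finsupp.mapDomain_single
    · push Not at hr
      refine (functionalCoord_of_forall_ne _ b hr).trans
        (functionalCoord_of_forall_ne φ b fun p hp => ?_).symm
      obtain ⟨p', hp'⟩ := CyclicQuiver.exists_path (CyclicQuiver.vertex (l.idx + 1)) r (l := m) (by
        rw [← CyclicQuiver.idx_add_length p, hp, CyclicQuiver.idx_vertex, Nat.cast_succ]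
        ring)
      exact hr p' hp'

end Standard

/-! ### The dimension formula -/

theorem lemma3p8 {k : Type*} [Field k] [IsAlgClosed k] (n ω : ℕ) [NeZero n] (hω : 1 ≤ ω)
    (x y : CyclicQuiver n → ℕ) (X Y : QuiverRep k (CyclicQuiver n))
    (hX : X = QuiverRep.sumCopies (fun i => BoundQuiver.projective k (ω * n) i) x)
    (hY : Y = QuiverRep.sumCopies (fun j => BoundQuiver.injective k (ω * n) j) y) (κ m : ℕ)
    (hκ : κ = ∑ i, x i) (hm : m = ∑ i, (x i + y i)) :
    topologicalKrullDim ((X.prod Y).Grassmannian X.dimVec) = ((ω * κ * (m - κ) : ℕ) : ℕ∞) := by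
  have : Infinite k := IsAlgClosed.instInfinite
  have hN : ((ω * n : ℕ) : ZMod n) = 0 := by simp
  have sX : StandardRep X (ω * n) fun s : Σ i, Fin (x i) => s.1.idx - 1 := by
    rw [hX]
    exact StandardRep.pi fun s => StandardRep.projective hN s.1
  have sY : StandardRep Y (ω * n) fun s : Σ i, Fin (y i) => s.1.idx := by
    rw [hY]
    exact StandardRep.pi fun s => StandardRep.injectiveRep s.1
  have cX : Fintype.card (Σ i, Fin (x i)) = κ := by simp [hκ]
  have cY : Fintype.card (Σ i, Fin (y i)) = m - κ := by
    simp [hκ, hm, Finset.sum_add_distrib]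
  have hκm : κ ≤ m := by
    rw [hκ, hm, Finset.sum_add_distrib]
    exact Nat.le_add_right _ _
  have cXY : Fintype.card ((Σ i, Fin (x i)) ⊕ (Σ i, Fin (y i))) = m := by
    rw [Fintype.card_sum, cX, cY]
    omega
  -- A string of length `ω n` passes every vertex `ω` times. The resulting constant dimension vector
  -- is what the bound on endomorphism rings requires.
  have he : ∀ i, X.dimVec i = ω * κ := fun i => by rw [sX.dimVec_eq i, cX]
  apply le_antisymm
  · have h := (sX.prod sY).topologicalKrullDim_le hω he (by omega)
    rwa [cXY] at h
  · have hfin : ∀ i, FiniteDimensional k (X.V i) := sX.finiteDimensional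
    have h := le_topologicalKrullDim_prod sX sY hN fun i => Module.finBasis k (X.V i)
    rwa [card_homCoord, cX, cY] at h
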